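/- **Setting.** A *factorisation system* $(\mathcal E,\mathcal M)$ on a category consists of two subcategories containing all isomorphisms such that every morphism factors as $m\circ e$ with $e\in\mathcal E$, $m\in\mathcal M$, and such that whenever $v\circ(m\circ e)=(m'\circ e')\circ u$ for factorisations of this kind there is a unique $s$ with $s\circ e=e'\circ u$ and $m'\circ s=v\circ m$. It is *costable* if $\mathcal M$ is stable under pushout along arbitrary morphisms. For a category $\mathcal C$ with finite colimits and a costable $(\mathcal E,\mathcal M)$, let $\mathcal C;\mathcal M^{\mathrm{op}}$ be the symmetric monoidal category (under $+$) whose objects are those of $\mathcal C$ and whose morphisms are isomorphism classes of cospans $\xrightarrow{c}\xleftarrow{m}$ with $m\in\mathcal M$, composed by pushout; for $f$ in $\mathcal C$ write $f$ also for the cospan $\xrightarrow{f}\xleftarrow{1}$, and for $m\in\mathcal M$ write $m^{\mathrm{op}}$ for $\xrightarrow{1}\xleftarrow{m}$. Let $(F,\varphi)\colon(\mathcal C;\mathcal M^{\mathrm{op}},+)\to(\mathrm{Set},\times)$ be a lax symmetric monoidal functor. A *decorated cospan* $X\to Y$ is a cospan $X\xrightarrow{i}N\xleftarrow{o}Y$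 in $\mathcal C$ with an element $s\in FN$; an isomorphism of decorated cospans is an isomorphism of apices commuting with the legs and carrying one decoration to the other. It is a *decorated corelation* if $[i,o]\colon X+Y\to N$ lies in $\mathcal E$. The *$\mathcal E$-part with restricted decoration* of a decorated cospan is $X\to\overline N\leftarrow Y$ with decoration $F(m^{\mathrm{op}})(s)$, where $X+Y\xrightarrow{e}\overline N\xrightarrow{m}N$ is the factorisation of $[i,o]$ and the legs are the components of $e$. The *empty decoration* on $N$ is the image of $1\xrightarrow{\varphi_1}F\varnothing\to FN$. $F\mathrm{Corel}$ is the hypergraph category whose objects are those of $\mathcal C$ and whose morphisms are isomorphism classes of decorated corelations. The composite of $(X\to N\leftarrow Y,s)$ and $(Y\to M\leftarrow Z,t)$ is the $\mathcal E$-part with restricted decoration of the pushout cospan with apex $N+_YM$, decorated by $F[j_N,j_M](\varphi_{N,M}(s,t))$. The monoidal product is coproduct of cospans, with decoration $\varphi_{N,M}(s,t)$. The identities, the coherence maps, and the Frobenius maps $\mu_X=[1,1]$, $\eta_X={!}$, $\delta_X=[1,1]^{\mathrm{op}}$, $\epsilon_X={!}^{\mathrm{op}}$ are the evident cospans with restricted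 empty decoration. (A *hypergraph category* is a symmetric monoidal category with a special commutative Frobenius structure on each object, compatible with $\otimes$. A *hypergraph functor* is a strong symmetric monoidal functor $(T,\kappa)$ such that the Frobenius structure on $TX$ is $(T\mu_X\circ\kappa_{X,X},\;T\eta_X\circ\kappa_1,\;\kappa_{X,X}^{-1}\circ T\delta_X,\;\kappa_1^{-1}\circ T\epsilon_X)$.) **Proposition.** Let $\mathcal C$, $\mathcal C'$ be categories with finite colimits and costable factorisation systems $(\mathcal E,\mathcal M)$, $(\mathcal E',\mathcal M')$, and let $$F\colon(\mathcal C;\mathcal M^{\mathrm{op}},+)\to(\mathrm{Set},\times),\qquad G\colon(\mathcal C';\mathcal M'^{\mathrm{op}},+)\to(\mathrm{Set},\times)$$ be lax symmetric monoidal functors. Let $A\colon\mathcal C\to\mathcal C'$ be a functor that preserves finite colimits and satisfies $A(\mathcal M)\subseteq\mathcal M'$, extended to the strong symmetric monoidal functor $A\colon\mathcal C;\mathcal M^{\mathrm{op}}\to\mathcal C';\mathcal M'^{\mathrm{op}}$ that applies $A$ to both legs of a cospan, with coherence maps the canonical isomorphisms $AX+AY\cong A(X+Y)$ and $\varnothing\cong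 A\varnothing$. Let $\theta\colon F\Rightarrow G\circ A$ be a monoidal natural transformation. Then there is a hypergraph functor $T\colon F\mathrm{Corel}\to G\mathrm{Corel}$ that sends each object $X$ to $AX$ and the class of each decorated corelation $(X\xrightarrow{i}N\xleftarrow{o}Y,\;s\in FN)$ to the class of $$\bigl(AX\xrightarrow{e'\circ\iota_{AX}}\overline{AN}\xleftarrow{e'\circ\iota_{AY}}AY,\quad G(m_{AN}^{\mathrm{op}})(\theta_N(s))\in G\overline{AN}\bigr),$$ where $AX+AY\xrightarrow{e'}\overline{AN}\xrightarrow{m_{AN}}AN$ is the $(\mathcal E',\mathcal M')$-factorisation of $[Ai,Ao]$. The coherence maps of $T$ are the canonical isomorphisms $AX+AY\to A(X+Y)$ and $\varnothing\to A\varnothing$, regarded as cospans with restricted empty decoration. -/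

import Mathlib

open CategoryTheory Limits MonoidalCategory

set_option linter.unusedSectionVars false

universe w v v' u u'

namespace DecoratedCorelations

noncomputable section

attribute [local simp] coprod.inl_desc coprod.inr_desc coprod.inl_desc_assoc coprod.inr_desc_assoc

section Cospans

variable {C : Type u} [Category.{v} C]

/-- A cospan `X ⟶ apex ⟵ Y`. -/
structure Csp (X Y : C) where
  apex : C
  i : X ⟶ apex
  o : Y ⟶ apex

namespace Csp

/-- Isomorphism of cospans with the same feet: an isomorphism of apices commuting with the legs. -/
def Rel {X Y : C} (a b : Csp X Y) : Prop :=
  ∃ n : a.apex ≅ b.apex, a.i ≫ n.hom = b.i ∧ a.o ≫ n.hom = b.o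

/-- A morphism `f` of `C`, as the cospan `X ⟶ Y = Y`. -/
abbrev ofHom {X Y : C} (f : X ⟶ Y) : Csp X Y := ⟨Y, f, 𝟙 Y⟩

/-- The cospan `f` reversed: `Y = Y ⟵ X`. -/
abbrev opHom {X Y : C} (f : X ⟶ Y) : Csp Y X := ⟨Y, 𝟙 Y, f⟩

variable [HasFiniteColimits C]

/-- Composition of cospans by pushout. -/
def comp {X Y Z : C} (a : Csp X Y) (b : Csp Y Z) : Csp X Z :=
  ⟨pushout a.o b.i, a.i ≫ pushout.inl a.o b.i, b.o ≫ pushout.inr a.o b.i⟩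

/-- The coproduct of two cospans. -/
abbrev tensor {X Y X' Y' : C} (a : Csp X Y) (b : Csp X' Y') : Csp (X ⨿ X') (Y ⨿ Y') :=
  ⟨a.apex ⨿ b.apex, coprod.map a.i b.i, coprod.map a.o b.o⟩

end Csp

/-! Auxiliary: cospans decorated by a functor to commutative monoids. -/

/-- A functor from `C` to commutative monoids, unbundled. -/
structure MonDecor (C : Type u) [Category.{v} C] where
  obj : C → Type w
  [mon : ∀ X, CommMonoid (obj X)]
  push : ∀ {X Y : C}, (X ⟶ Y) → (obj X →* obj Y)
  push_id : ∀ (X : C) (x : obj X), push (𝟙 X) x = x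
  push_push : ∀ {X Y Z : C} (f : X ⟶ Y) (g : Y ⟶ Z) (x : obj X),
    push g (push f x) = push (f ≫ g) x

attribute [instance] MonDecor.mon
attribute [simp] MonDecor.push_id MonDecor.push_push

structure DCsp (H : MonDecor.{w} C) (X Y : C) extends Csp X Y where
  dec : H.obj apex

namespace DCsp

variable {H : MonDecor.{w} C}

def Rel {X Y : C} (a b : DCsp H X Y) : Prop :=
  ∃ n : a.apex ≅ b.apex, a.i ≫ n.hom = b.i ∧ a.o ≫ n.hom = b.o ∧ H.push n.hom a.dec = b.dec

lemma Rel.refl {X Y : C} (a : DCsp H X Y) : Rel a a := ⟨Iso.refl _, by simp⟩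

lemma Rel.of_eq {X Y : C} {a b : DCsp H X Y} (h : a = b) : Rel a b := h ▸ Rel.refl a

lemma Rel.symm {X Y : C} {a b : DCsp H X Y} : Rel a b → Rel b a := by
  rintro ⟨n, h1, h2, h3⟩
  refine ⟨n.symm, ?_, ?_, ?_⟩
  · simp [← h1]
  · simp [← h2]
  · simp [← h3]

lemma Rel.trans {X Y : C} {a b c : DCsp H X Y} : Rel a b → Rel b c → Rel a c := by
  rintro ⟨n, h1, h2, h3⟩ ⟨m, k1, k2, k3⟩
  refine ⟨n ≪≫ m, ?_, ?_, ?_⟩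
  · simp [← k1, ← h1]
  · simp [← k2, ← h2]
  · simp [← k3, ← h3]

abbrev ofHom {X Y : C} (f : X ⟶ Y) : DCsp H X Y := ⟨⟨Y, f, 𝟙 Y⟩, (1 : H.obj Y)⟩

abbrev opHom {X Y : C} (f : X ⟶ Y) : DCsp H Y X := ⟨⟨Y, 𝟙 Y, f⟩, (1 : H.obj Y)⟩

abbrev releg {X Y X' Y' : C} (f : X' ⟶ X) (g : Y' ⟶ Y) (a : DCsp H X Y) : DCsp H X' Y' :=
  ⟨⟨a.apex, f ≫ a.i, g ≫ a.o⟩, a.dec⟩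

/-- `c` is a composite of `a` and `b`, formed with some pushout. -/
def IsComp {X Y Z : C} (a : DCsp H X Y) (b : DCsp H Y Z) (c : DCsp H X Z) : Prop :=
  ∃ (j : a.apex ⟶ c.apex) (k : b.apex ⟶ c.apex), IsPushout a.o b.i j k ∧ a.i ≫ j = c.i ∧
    b.o ≫ k = c.o ∧ H.push j a.dec * H.push k b.dec = c.dec

lemma ext' {X Y N : C} {i i' : X ⟶ N} {o o' : Y ⟶ N} {s s' : H.obj N} (h1 : i = i')
    (h2 : o = o') (h3 : s = s') : (⟨⟨N, i, o⟩, s⟩ : DCsp H X Y) = ⟨⟨N, i', o'⟩, s'⟩ := by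
  subst h1 h2 h3; rfl

lemma mkRel {X Y N N' : C} {i : X ⟶ N} {o : Y ⟶ N} {s : H.obj N} {i' : X ⟶ N'} {o' : Y ⟶ N'}
    {s' : H.obj N'} (n : N ≅ N') (h1 : i ≫ n.hom = i') (h2 : o ≫ n.hom = o')
    (h3 : H.push n.hom s = s') : Rel (⟨⟨N, i, o⟩, s⟩ : DCsp H X Y) ⟨⟨N', i', o'⟩, s'⟩ :=
  ⟨n, h1, h2, h3⟩

lemma mkComp {X Y Z N M P : C} {i : X ⟶ N} {o : Y ⟶ N} {s : H.obj N} {i' : Y ⟶ M} {o' : Z ⟶ M}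
    {s' : H.obj M} {i'' : X ⟶ P} {o'' : Z ⟶ P} {s'' : H.obj P} (j : N ⟶ P) (k : M ⟶ P)
    (sq : IsPushout o i' j k) (h1 : i ≫ j = i'') (h2 : o' ≫ k = o'')
    (h3 : H.push j s * H.push k s' = s'') :
    IsComp (⟨⟨N, i, o⟩, s⟩ : DCsp H X Y) ⟨⟨M, i', o'⟩, s'⟩ ⟨⟨P, i'', o''⟩, s''⟩ :=
  ⟨j, k, sq, h1, h2, h3⟩

lemma isPushout_of {X Y Z P : C} {f : X ⟶ Y} {g : X ⟶ Z} {j : Y ⟶ P} {k : Z ⟶ P}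
    (w : f ≫ j = g ≫ k)
    (h : ∀ (T : C) (p : Y ⟶ T) (q : Z ⟶ T), f ≫ p = g ≫ q → ∃ d : P ⟶ T, j ≫ d = p ∧ k ≫ d = q)
    (ext : ∀ (T : C) (d d' : P ⟶ T), j ≫ d = j ≫ d' → k ≫ d = k ≫ d' → d = d') :
    IsPushout f g j k :=
  ⟨⟨w⟩, ⟨PushoutCocone.IsColimit.mk _ (fun t => (h t.pt t.inl t.inr t.condition).choose)
    (fun t => (h t.pt t.inl t.inr t.condition).choose_spec.1)
    (fun t => (h t.pt t.inl t.inr t.condition).choose_spec.2)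
    (fun t _ h1 h2 => ext _ _ _
      (h1.trans (h t.pt t.inl t.inr t.condition).choose_spec.1.symm)
      (h2.trans (h t.pt t.inl t.inr t.condition).choose_spec.2.symm))⟩⟩

lemma IsComp.rel {X Y Z : C} {a a' : DCsp H X Y} {b b' : DCsp H Y Z} {c c' : DCsp H X Z} :
    IsComp a b c → IsComp a' b' c' → Rel a a' → Rel b b' → Rel c c' := by
  rintro ⟨j, k, sq, hi, ho, hd⟩ ⟨j', k', sq', hi', ho', hd'⟩ ⟨n, h1, h2, h3⟩ ⟨m, k1, k2, k3⟩
  have sq2 : IsPushout a.o b.i (n.hom ≫ j') (m.hom ≫ k') :=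
    IsPushout.of_iso sq' (Iso.refl _) n.symm m.symm (Iso.refl _) (by simp [← h2])
      (by simp [← k1]) (by simp) (by simp)
  refine ⟨sq.isoIsPushout _ _ sq2, ?_, ?_, ?_⟩
  · simp [← hi, ← hi', ← h1]
  · simp [← ho, ← ho', ← k2]
  · simp [← hd, ← hd', ← h3, ← k3]

lemma ofHom_rel_opHom {X Y : C} (f : X ≅ Y) : Rel (ofHom (H := H) f.hom) (opHom f.inv) :=
  mkRel f.symm (by simp) (by simp) (by simp)

lemma IsComp.assoc {W X Y Z : C} {a : DCsp H W X} {b : DCsp H X Y} {c : DCsp H Y Z}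
    {ab : DCsp H W Y} {bc : DCsp H X Z} {abc : DCsp H W Z} :
    IsComp a b ab → IsComp b c bc → IsComp a bc abc → IsComp ab c abc := by
  rintro ⟨j, k, sq, hi, ho, hd⟩ ⟨j', k', sq', hi', ho', hd'⟩ ⟨j'', k'', sq'', hi'', ho'', hd''⟩
  have w : a.o ≫ j'' = b.i ≫ j' ≫ k'' := by rw [sq''.w, ← hi', Category.assoc]
  have h1 : j ≫ sq.desc _ _ w = j'' := by simp
  have h2 : k ≫ sq.desc _ _ w = j' ≫ k'' := by simp
  have t : IsPushout k j' (sq.desc _ _ w) k'' :=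
    (IsPushout.of_left (by rw [h1, hi']; exact sq''.flip) h2.symm sq.flip).flip
  refine ⟨sq.desc _ _ w, k' ≫ k'', ?_, ?_, ?_, ?_⟩
  · rw [← ho]; exact sq'.paste_horiz t
  · simp [← hi, hi'']
  · simp [← ho'', ← ho']
  · simp [← hd, ← hd', ← hd'', mul_assoc]

lemma releg_id {X Y : C} (a : DCsp H X Y) : a.releg (𝟙 X) (𝟙 Y) = a := by
  exact ext' (Category.id_comp _) (Category.id_comp _) rfl

variable [HasFiniteColimits C]

def comp {X Y Z : C} (a : DCsp H X Y) (b : DCsp H Y Z) : DCsp H X Z :=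
  ⟨a.toCsp.comp b.toCsp,
    H.push (pushout.inl a.o b.i) a.dec * H.push (pushout.inr a.o b.i) b.dec⟩

abbrev tensor {X Y X' Y' : C} (a : DCsp H X Y) (b : DCsp H X' Y') :
    DCsp H (X ⨿ X') (Y ⨿ Y') :=
  ⟨⟨a.apex ⨿ b.apex, coprod.map a.i b.i, coprod.map a.o b.o⟩,
    H.push (coprod.inl : a.apex ⟶ a.apex ⨿ b.apex) a.dec *
      H.push (coprod.inr : b.apex ⟶ a.apex ⨿ b.apex) b.dec⟩

lemma isComp_comp {X Y Z : C} (a : DCsp H X Y) (b : DCsp H Y Z) : IsComp a b (a.comp b) :=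
  ⟨_, _, IsPushout.of_hasPushout _ _, rfl, rfl, rfl⟩

lemma IsComp.comp_rel {X Y Z : C} {a : DCsp H X Y} {b : DCsp H Y Z} {c : DCsp H X Z}
    (h : IsComp a b c) : Rel (a.comp b) c :=
  (isComp_comp a b).rel h (Rel.refl _) (Rel.refl _)

lemma comp_congr {X Y Z : C} {a a' : DCsp H X Y} {b b' : DCsp H Y Z}
    (h : Rel a a') (h' : Rel b b') : Rel (a.comp b) (a'.comp b') :=
  (isComp_comp a b).rel (isComp_comp a' b') h h'

lemma comp_assoc {W X Y Z : C} (a : DCsp H W X) (b : DCsp H X Y) (c : DCsp H Y Z) :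
    Rel ((a.comp b).comp c) (a.comp (b.comp c)) :=
  ((isComp_comp a b).assoc (isComp_comp b c) (isComp_comp a _)).comp_rel

lemma ofHom_comp {X Y Z : C} (f : X ⟶ Y) (a : DCsp H Y Z) :
    Rel ((ofHom f).comp a) (a.releg f (𝟙 Z)) :=
  IsComp.comp_rel (mkComp a.i (𝟙 a.apex) (IsPushout.of_horiz_isIso ⟨by simp⟩) rfl (by simp)
    (by simp))

lemma comp_opHom {X Y Z : C} (a : DCsp H X Y) (f : Z ⟶ Y) :
    Rel (a.comp (opHom f)) (a.releg (𝟙 X) f) :=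
  IsComp.comp_rel (mkComp (𝟙 a.apex) a.o (IsPushout.of_vert_isIso ⟨by simp⟩) (by simp) rfl
    (by simp))

lemma comp_ofHom {X Y Z : C} (a : DCsp H X Y) (f : Y ≅ Z) :
    Rel (a.comp (ofHom f.hom)) (a.releg (𝟙 X) f.inv) :=
  IsComp.comp_rel (mkComp (𝟙 a.apex) (f.inv ≫ a.o) (IsPushout.of_vert_isIso ⟨by simp⟩) (by simp)
    (by simp) (by simp))

lemma id_comp {X Y : C} (a : DCsp H X Y) : Rel ((ofHom (𝟙 X)).comp a) a := by
  simpa [releg_id] using ofHom_comp (𝟙 X) a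

lemma comp_id {X Y : C} (a : DCsp H X Y) : Rel (a.comp (ofHom (𝟙 Y))) a := by
  simpa [releg_id] using comp_ofHom a (Iso.refl Y)

lemma natural {X Y X' Y' N N' : C} {i : X ⟶ N} {o : Y ⟶ N} {s : H.obj N} {i' : X' ⟶ N'}
    {o' : Y' ⟶ N'} {s' : H.obj N'} (f : X ⟶ X') (g : Y ≅ Y')
    (n : N ≅ N') (h1 : i ≫ n.hom = f ≫ i') (h2 : o ≫ n.hom = g.hom ≫ o')
    (h3 : H.push n.hom s = s') :
    Rel ((⟨⟨N, i, o⟩, s⟩ : DCsp H X Y).comp (ofHom g.hom))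
      ((ofHom f).comp (⟨⟨N', i', o'⟩, s'⟩ : DCsp H X' Y')) := by
  refine (comp_ofHom _ g).trans (Rel.trans ?_ (ofHom_comp f _).symm)
  exact mkRel n (by simp [h1]) (by simp [h2]) h3

lemma tensor_congr {X Y X' Y' : C} {a a' : DCsp H X Y} {b b' : DCsp H X' Y'} :
    Rel a a' → Rel b b' → Rel (a.tensor b) (a'.tensor b') := by
  rintro ⟨n, h1, h2, h3⟩ ⟨m, k1, k2, k3⟩
  refine mkRel (coprod.mapIso n m) ?_ ?_ ?_
  · simp [h1, k1]
  · simp [h2, k2]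
  · simp [← h3, ← k3]

lemma isPushout_coprod_map {W X Y Z W' X' Y' Z' : C} {f : W ⟶ X} {g : W ⟶ Y} {j : X ⟶ Z}
    {k : Y ⟶ Z} {f' : W' ⟶ X'} {g' : W' ⟶ Y'} {j' : X' ⟶ Z'} {k' : Y' ⟶ Z'}
    (s : IsPushout f g j k) (s' : IsPushout f' g' j' k') :
    IsPushout (coprod.map f f') (coprod.map g g') (coprod.map j j') (coprod.map k k') := by
  refine isPushout_of (by simp [s.w, s'.w]) (fun T p q w => ?_) (fun T d d' h1 h2 => ?_)
  · have w1 : f ≫ coprod.inl ≫ p = g ≫ coprod.inl ≫ q := by simpa using coprod.inl ≫= w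
    have w2 : f' ≫ coprod.inr ≫ p = g' ≫ coprod.inr ≫ q := by simpa using coprod.inr ≫= w
    refine ⟨coprod.desc (s.desc _ _ w1) (s'.desc _ _ w2), ?_, ?_⟩ <;>
      apply coprod.hom_ext <;> simp
  · apply coprod.hom_ext
    · apply s.hom_ext
      · simpa using coprod.inl ≫= h1
      · simpa using coprod.inl ≫= h2
    · apply s'.hom_ext
      · simpa using coprod.inr ≫= h1
      · simpa using coprod.inr ≫= h2

lemma IsComp.tensor {X Y Z X' Y' Z' : C} {a : DCsp H X Y} {b : DCsp H Y Z} {c : DCsp H X Z}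
    {a' : DCsp H X' Y'} {b' : DCsp H Y' Z'} {c' : DCsp H X' Z'} :
    IsComp a b c → IsComp a' b' c' → IsComp (a.tensor a') (b.tensor b') (c.tensor c') := by
  rintro ⟨j, k, sq, hi, ho, hd⟩ ⟨j', k', sq', hi', ho', hd'⟩
  refine mkComp (coprod.map j j') (coprod.map k k') (isPushout_coprod_map sq sq') ?_ ?_ ?_
  · simp [hi, hi']
  · simp [ho, ho']
  · simp only [map_mul, MonDecor.push_push, coprod.inl_map, coprod.inr_map, ← hd, ← hd']
    ac_rfl

lemma tensor_comp {X Y Z X' Y' Z' : C} (a : DCsp H X Y) (b : DCsp H Y Z)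
    (a' : DCsp H X' Y') (b' : DCsp H Y' Z') :
    Rel ((a.tensor a').comp (b.tensor b')) ((a.comp b).tensor (a'.comp b')) :=
  ((isComp_comp a b).tensor (isComp_comp a' b')).comp_rel

lemma ofHom_tensor {X Y X' Y' : C} (f : X ⟶ Y) (g : X' ⟶ Y') :
    (ofHom (H := H) f).tensor (ofHom g) = ofHom (coprod.map f g) := by
  have h : H.push coprod.inl 1 * H.push coprod.inr 1 = (1 : H.obj (Y ⨿ Y')) := by simp
  exact DCsp.ext' rfl (by simp) h

lemma opHom_tensor {X Y X' Y' : C} (f : X ⟶ Y) (g : X' ⟶ Y') :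
    (opHom (H := H) f).tensor (opHom g) = opHom (coprod.map f g) := by
  have h : H.push coprod.inl 1 * H.push coprod.inr 1 = (1 : H.obj (Y ⨿ Y')) := by simp
  exact DCsp.ext' (by simp) rfl h

lemma ofHom_comp_ofHom {X Y Z : C} (f : X ⟶ Y) (g : Y ⟶ Z) :
    Rel ((ofHom (H := H) f).comp (ofHom g)) (ofHom (f ≫ g)) :=
  (ofHom_comp f (ofHom g)).trans (mkRel (Iso.refl _) (by simp) (by simp) (by simp))

lemma opHom_comp_opHom {X Y Z : C} (f : X ⟶ Y) (g : Y ⟶ Z) :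
    Rel ((opHom (H := H) g).comp (opHom f)) (opHom (f ≫ g)) :=
  (comp_opHom (opHom g) f).trans (mkRel (Iso.refl _) (by simp) (by simp) (by simp))

lemma opHom_comp_ofHom {X Y Z P : C} {f : X ⟶ Y} {g : X ⟶ Z} {j : Y ⟶ P} {k : Z ⟶ P}
    (s : IsPushout f g j k) :
    Rel ((opHom (H := H) f).comp (ofHom g)) ⟨⟨P, j, k⟩, 1⟩ :=
  IsComp.comp_rel (mkComp j k s (by simp) (by simp) (by simp))

lemma ofHom_comp_opHom {X Y Z : C} (f : X ⟶ Y) (g : Z ⟶ Y) :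
    Rel ((ofHom (H := H) f).comp (opHom g)) ⟨⟨Y, f, g⟩, 1⟩ :=
  (ofHom_comp f (opHom g)).trans (mkRel (Iso.refl _) (by simp) (by simp) (by simp))

lemma assoc_natural {X Y X' Y' X'' Y'' : C} (a : DCsp H X Y) (b : DCsp H X' Y')
    (c : DCsp H X'' Y'') :
    Rel (((a.tensor b).tensor c).comp (ofHom (coprod.associator Y Y' Y'').hom))
      ((ofHom (coprod.associator X X' X'').hom).comp (a.tensor (b.tensor c))) := by
  refine natural _ _ (coprod.associator _ _ _) ?_ ?_ ?_
  · exact coprod.associator_naturality _ _ _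
  · exact coprod.associator_naturality _ _ _
  · simp [mul_assoc]

lemma leftUnitor_natural {X Y : C} (a : DCsp H X Y) :
    Rel (((ofHom (𝟙 (⊥_ C))).tensor a).comp (ofHom (coprod.leftUnitor Y).hom))
      ((ofHom (coprod.leftUnitor X).hom).comp a) := by
  refine natural _ _ (coprod.leftUnitor _) ?_ ?_ ?_
  · exact coprod.leftUnitor_naturality _
  · exact coprod.leftUnitor_naturality _
  · simp

lemma rightUnitor_natural {X Y : C} (a : DCsp H X Y) :
    Rel ((a.tensor (ofHom (𝟙 (⊥_ C)))).comp (ofHom (coprod.rightUnitor Y).hom))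
      ((ofHom (coprod.rightUnitor X).hom).comp a) := by
  refine natural _ _ (coprod.rightUnitor _) ?_ ?_ ?_
  · exact coprod.rightUnitor_naturality _
  · exact coprod.rightUnitor_naturality _
  · simp

lemma braiding_natural {X Y X' Y' : C} (a : DCsp H X Y) (b : DCsp H X' Y') :
    Rel ((a.tensor b).comp (ofHom (coprod.braiding Y Y').hom))
      ((ofHom (coprod.braiding X X').hom).comp (b.tensor a)) := by
  refine natural _ _ (coprod.braiding _ _) ?_ ?_ ?_
  · simp
  · simp
  · simp [mul_comm]

end DCsp

end Cospans

section AdjoinOp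

variable {C : Type u} [Category.{v} C]

namespace Csp

/-- The one-point decoration. -/
def trivialDecor (C : Type u) [Category.{v} C] : MonDecor.{0} C where
  obj _ := PUnit
  push _ := 1
  push_id _ _ := rfl
  push_push _ _ _ := rfl

abbrev toD {X Y : C} (a : Csp X Y) : DCsp (trivialDecor C) X Y := ⟨a, (1 : PUnit)⟩

lemma rel_of_toD {X Y : C} {a b : Csp X Y} : DCsp.Rel a.toD b.toD → Rel a b := by
  rintro ⟨n, h1, h2, _⟩
  exact ⟨n, h1, h2⟩

lemma Rel.toD {X Y : C} {a b : Csp X Y} : Rel a b → DCsp.Rel a.toD b.toD := by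
  rintro ⟨n, h1, h2⟩
  exact ⟨n, h1, h2, rfl⟩

lemma rel_equivalence (X Y : C) : Equivalence (Rel (X := X) (Y := Y)) where
  refl _ := rel_of_toD (DCsp.Rel.refl _)
  symm h := rel_of_toD h.toD.symm
  trans h h' := rel_of_toD (h.toD.trans h'.toD)

end Csp

/-- The objects of `C ; Mᵒᵖ`, where `M` is a class of morphisms of `C`: the objects of `C`. -/
structure AdjoinOp (M : MorphismProperty C) where
  of : C

namespace AdjoinOp

variable (M : MorphismProperty C)

/-- Cospans whose right leg lies in `M`, up to isomorphism of cospans. -/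
def homSetoid (X Y : C) : Setoid {a : Csp X Y // M a.o} where
  r a b := Csp.Rel a.1 b.1
  iseqv :=
    { refl := fun a => (Csp.rel_equivalence X Y).refl a.1
      symm := fun h => (Csp.rel_equivalence X Y).symm h
      trans := fun h h' => (Csp.rel_equivalence X Y).trans h h' }

variable {M}

/-- Morphisms of `C ; Mᵒᵖ`. -/
def Hom (X Y : AdjoinOp M) := Quotient (homSetoid M X.of Y.of)

/-- The morphism represented by a cospan with right leg in `M`. -/
def Hom.mk {X Y : AdjoinOp M} (a : Csp X.of Y.of) (h : M a.o) : Hom X Y :=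
  Quotient.mk (homSetoid M X.of Y.of) ⟨a, h⟩

lemma Hom.sound {X Y : AdjoinOp M} {a b : Csp X.of Y.of} {h : M a.o} {h' : M b.o}
    (r : DCsp.Rel a.toD b.toD) : Hom.mk a h = Hom.mk b h' :=
  Quotient.sound (s := homSetoid M X.of Y.of) (Csp.rel_of_toD r)

@[elab_as_elim]
lemma Hom.ind {X Y : AdjoinOp M} {p : Hom X Y → Prop} (h : ∀ a ha, p (Hom.mk a ha)) (f : Hom X Y) :
    p f :=
  Quotient.ind (fun a => h a.1 a.2) f

variable [HasFiniteColimits C] [M.IsMultiplicative] [M.IsStableUnderCobaseChange]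

lemma comp_mem {X Y Z : C} {a : Csp X Y} {b : Csp Y Z} (ha : M a.o) (hb : M b.o) :
    M (a.comp b).o :=
  M.comp_mem _ _ hb (MorphismProperty.IsStableUnderCobaseChange.of_isPushout
    (IsPushout.of_hasPushout a.o b.i).flip ha)

lemma coprod_map_id_mem {X Y : C} (m : X ⟶ Y) (hm : M m) (Z : C) : M (coprod.map m (𝟙 Z)) :=
  MorphismProperty.IsStableUnderCobaseChange.of_isPushout
    (IsPushout.of_coprod_inl_with_id m Z) hm

lemma coprod_map_mem {X Y X' Y' : C} {m : X ⟶ Y} {m' : X' ⟶ Y'} (hm : M m) (hm' : M m') :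
    M (coprod.map m m') := by
  have h1 := coprod_map_id_mem m hm X'
  have h2 := coprod_map_id_mem m' hm' Y
  have h3 : M (coprod.map (𝟙 Y) m') :=
    (M.arrow_mk_iso_iff (Arrow.isoMk (coprod.braiding _ _) (coprod.braiding _ _) (by simp))).1 h2
  simpa using M.comp_mem _ _ h1 h3

/-- The category `C ; Mᵒᵖ`: isomorphism classes of cospans with right leg in `M`, composed by
pushout. -/
instance : Category (AdjoinOp M) where
  Hom X Y := Hom X Y
  id X := Hom.mk (Csp.ofHom (𝟙 X.of)) (M.id_mem _)
  comp {X Y Z} f g := Quotient.map₂ (sa := homSetoid M X.of Y.of) (sb := homSetoid M Y.of Z.of)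
    (sc := homSetoid M X.of Z.of) (fun a b => ⟨a.1.comp b.1, comp_mem a.2 b.2⟩)
    (fun _ _ h _ _ h' => Csp.rel_of_toD
      (DCsp.comp_congr (Csp.Rel.toD h) (Csp.Rel.toD h'))) f g
  id_comp f := Hom.ind (fun a _ => Hom.sound (DCsp.id_comp a.toD)) f
  comp_id f := Hom.ind (fun a _ => Hom.sound (DCsp.comp_id a.toD)) f
  assoc f g h := Hom.ind (fun a _ => Hom.ind (fun b _ => Hom.ind (fun c _ =>
    Hom.sound (DCsp.comp_assoc a.toD b.toD c.toD)) h) g) f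

/-- The morphism of `C ; Mᵒᵖ` represented by a cospan with right leg in `M`. -/
def homMk {X Y : AdjoinOp M} (a : Csp X.of Y.of) (h : M a.o) : X ⟶ Y := Hom.mk a h

/-- A morphism `f` of `C`, as the morphism `X ⟶ Y = Y` of `C ; Mᵒᵖ`. -/
def ofHom {X Y : C} (f : X ⟶ Y) : (⟨X⟩ : AdjoinOp M) ⟶ ⟨Y⟩ := homMk (Csp.ofHom f) (M.id_mem _)

/-- A morphism `m` of `M`, reversed: the morphism `Y = Y ⟵ X` of `C ; Mᵒᵖ`. -/
def opHom {X Y : C} (m : X ⟶ Y) (hm : M m) : (⟨Y⟩ : AdjoinOp M) ⟶ ⟨X⟩ := homMk (Csp.opHom m) hm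

lemma sound {X Y : AdjoinOp M} {a b : Csp X.of Y.of} {h : M a.o} {h' : M b.o}
    (r : DCsp.Rel a.toD b.toD) : homMk a h = homMk b h' := Hom.sound r

@[elab_as_elim]
lemma ind {X Y : AdjoinOp M} {p : (X ⟶ Y) → Prop} (h : ∀ a ha, p (homMk a ha)) (f : X ⟶ Y) :
    p f := Hom.ind h f

lemma homMk_comp {X Y Z : AdjoinOp M} (a : Csp X.of Y.of) (ha) (b : Csp Y.of Z.of) (hb) :
    (homMk a ha : X ⟶ Y) ≫ (homMk b hb : Y ⟶ Z) = homMk (a.comp b) (comp_mem ha hb) := rfl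

lemma ofHom_id (X : C) : (ofHom (𝟙 X) : (⟨X⟩ : AdjoinOp M) ⟶ ⟨X⟩) = 𝟙 _ := rfl

lemma ofHom_comp {X Y Z : C} (f : X ⟶ Y) (g : Y ⟶ Z) :
    (ofHom (f ≫ g) : (⟨X⟩ : AdjoinOp M) ⟶ _) = ofHom f ≫ ofHom g :=
  (sound (M := M) (X := ⟨X⟩) (Y := ⟨Z⟩) (a := (Csp.ofHom f).comp (Csp.ofHom g))
    (b := Csp.ofHom (f ≫ g)) (DCsp.ofHom_comp_ofHom f g)).symm

lemma opHom_comp {X Y Z : C} (f : X ⟶ Y) (g : Y ⟶ Z) (hf : M f) (hg : M g) :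
    (opHom (f ≫ g) (M.comp_mem _ _ hf hg) : (⟨Z⟩ : AdjoinOp M) ⟶ _) = opHom g hg ≫ opHom f hf :=
  (sound (M := M) (X := ⟨Z⟩) (Y := ⟨X⟩) (a := (Csp.opHom g).comp (Csp.opHom f))
    (b := Csp.opHom (f ≫ g)) (DCsp.opHom_comp_opHom f g)).symm

/-- The isomorphism of `C ; Mᵒᵖ` given by an isomorphism of `C`. -/
def isoOf {X Y : C} (f : X ≅ Y) : (⟨X⟩ : AdjoinOp M) ≅ ⟨Y⟩ where
  hom := ofHom f.hom
  inv := ofHom f.inv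
  hom_inv_id := by rw [← ofHom_comp, f.hom_inv_id, ofHom_id]
  inv_hom_id := by rw [← ofHom_comp, f.inv_hom_id, ofHom_id]

/-- The tensor product of morphisms of `C ; Mᵒᵖ`: the coproduct of cospans. -/
def tensorHom {X Y X' Y' : AdjoinOp M} (f : X ⟶ Y) (g : X' ⟶ Y') :
    (⟨X.of ⨿ X'.of⟩ : AdjoinOp M) ⟶ ⟨Y.of ⨿ Y'.of⟩ :=
  Quotient.map₂ (sa := homSetoid M X.of Y.of) (sb := homSetoid M X'.of Y'.of)
    (sc := homSetoid M (X.of ⨿ X'.of) (Y.of ⨿ Y'.of))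
    (fun a b => ⟨a.1.tensor b.1, coprod_map_mem a.2 b.2⟩)
    (fun _ _ h _ _ h' => Csp.rel_of_toD
      (DCsp.tensor_congr (Csp.Rel.toD h) (Csp.Rel.toD h'))) f g

lemma ofHom_tensor {X Y X' Y' : C} (f : X ⟶ Y) (g : X' ⟶ Y') :
    tensorHom (M := M) (ofHom f) (ofHom g) = ofHom (coprod.map f g) :=
  sound (M := M) (X := ⟨X ⨿ X'⟩) (Y := ⟨Y ⨿ Y'⟩) (a := (Csp.ofHom f).tensor (Csp.ofHom g)) (b := Csp.ofHom (coprod.map f g))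
    (DCsp.Rel.of_eq (DCsp.ofHom_tensor f g))

lemma tensorHom_braiding {X Y X' Y' : AdjoinOp M} (f : X ⟶ Y) (g : X' ⟶ Y') :
    tensorHom f g ≫ ofHom (coprod.braiding Y.of Y'.of).hom =
      ofHom (coprod.braiding X.of X'.of).hom ≫ tensorHom g f :=
  ind (fun a _ => ind (fun b _ => sound (X := ⟨X.of ⨿ X'.of⟩) (Y := ⟨Y'.of ⨿ Y.of⟩)
    (a := (a.tensor b).comp (Csp.ofHom (coprod.braiding Y.of Y'.of).hom))
    (b := (Csp.ofHom (coprod.braiding X.of X'.of).hom).comp (b.tensor a))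
    (DCsp.braiding_natural a.toD b.toD)) g) f

instance : MonoidalCategoryStruct (AdjoinOp M) where
  tensorObj X Y := ⟨X.of ⨿ Y.of⟩
  whiskerLeft X _ _ f := tensorHom (𝟙 X) f
  whiskerRight f Y := tensorHom f (𝟙 Y)
  tensorHom f g := tensorHom f g
  tensorUnit := ⟨⊥_ C⟩
  associator X Y Z := isoOf (coprod.associator X.of Y.of Z.of)
  leftUnitor X := isoOf (coprod.leftUnitor X.of)
  rightUnitor X := isoOf (coprod.rightUnitor X.of)

instance : MonoidalCategory (AdjoinOp M) := MonoidalCategory.ofTensorHom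
  (id_tensorHom_id := fun X Y => by
    refine (ofHom_tensor (M := M) (𝟙 X.of) (𝟙 Y.of)).trans ?_
    rw [coprod.map_id_id]; rfl)
  (id_tensorHom := fun _ _ _ _ => rfl)
  (tensorHom_id := fun _ _ => rfl)
  (tensorHom_comp_tensorHom := fun {X₁ _ Z₁ X₂ _ Z₂} f₁ f₂ g₁ g₂ =>
    ind (fun a _ => ind (fun b _ => ind (fun c _ => ind (fun d _ =>
      sound (X := ⟨X₁.of ⨿ X₂.of⟩) (Y := ⟨Z₁.of ⨿ Z₂.of⟩)
        (a := (a.tensor b).comp (c.tensor d)) (b := (a.comp c).tensor (b.comp d))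
        (DCsp.tensor_comp a.toD c.toD b.toD d.toD)) g₂) g₁) f₂) f₁)
  (associator_naturality := fun f₁ f₂ f₃ =>
    ind (fun a _ => ind (fun b _ => ind (fun c _ =>
      sound (DCsp.assoc_natural a.toD b.toD c.toD)) f₃) f₂) f₁)
  (leftUnitor_naturality := fun f => ind (fun a _ => sound (DCsp.leftUnitor_natural a.toD)) f)
  (rightUnitor_naturality := fun f => ind (fun a _ => sound (DCsp.rightUnitor_natural a.toD)) f)
  (pentagon := fun W X Y Z => by
    have h := congrArg (ofHom (M := M)) (coprod.pentagon W.of X.of Y.of Z.of)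
    simp only [ofHom_comp, ← ofHom_tensor] at h
    exact h)
  (triangle := fun X Y => by
    have h := congrArg (ofHom (M := M)) (coprod.triangle X.of Y.of)
    simp only [ofHom_comp, ← ofHom_tensor] at h
    exact h)

instance : SymmetricCategory (AdjoinOp M) where
  braiding X Y := (isoOf (coprod.braiding X.of Y.of) :
    (⟨X.of ⨿ Y.of⟩ : AdjoinOp M) ≅ ⟨Y.of ⨿ X.of⟩)
  braiding_naturality_right X _ _ f := tensorHom_braiding (𝟙 X) f
  braiding_naturality_left f Z := tensorHom_braiding f (𝟙 Z)
  hexagon_forward X Y Z := by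
    have h := congrArg (ofHom (M := M)) (show
      (coprod.associator X.of Y.of Z.of).hom ≫ (coprod.braiding X.of (Y.of ⨿ Z.of)).hom ≫
        (coprod.associator Y.of Z.of X.of).hom =
      coprod.map (coprod.braiding X.of Y.of).hom (𝟙 Z.of) ≫ (coprod.associator Y.of X.of Z.of).hom ≫
        coprod.map (𝟙 Y.of) (coprod.braiding X.of Z.of).hom by simp)
    simp only [ofHom_comp, ← ofHom_tensor] at h
    exact h
  hexagon_reverse X Y Z := by
    have h := congrArg (ofHom (M := M)) (show
      (coprod.associator X.of Y.of Z.of).inv ≫ (coprod.braiding (X.of ⨿ Y.of) Z.of).hom ≫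
        (coprod.associator Z.of X.of Y.of).inv =
      coprod.map (𝟙 X.of) (coprod.braiding Y.of Z.of).hom ≫ (coprod.associator X.of Z.of Y.of).inv ≫
        coprod.map (coprod.braiding X.of Z.of).hom (𝟙 Y.of) by simp)
    simp only [ofHom_comp, ← ofHom_tensor] at h
    exact h
  symmetry X Y := by
    have h := congrArg (ofHom (M := M)) (coprod.symmetry X.of Y.of)
    simp only [ofHom_comp] at h
    exact h

end AdjoinOp
end AdjoinOp

section MapAdjoinOp

variable {C : Type u} [Category.{v} C] {C' : Type u'} [Category.{v'} C']

/-- The image of a cospan under a functor. -/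
abbrev Csp.map (A : C ⥤ C') {X Y : C} (a : Csp X Y) : Csp (A.obj X) (A.obj Y) :=
  ⟨A.obj a.apex, A.map a.i, A.map a.o⟩

lemma Csp.Rel.map (A : C ⥤ C') {X Y : C} {a b : Csp X Y} :
    Csp.Rel a b → Csp.Rel (a.map A) (b.map A) := by
  rintro ⟨n, h1, h2⟩
  exact ⟨A.mapIso n, by simp [← h1], by simp [← h2]⟩

/-- The comparison `A X ⨿ A Y ≅ A (X ⨿ Y)`, for `A` preserving finite colimits. -/
def kappa [HasFiniteColimits C] [HasFiniteColimits C'] (A : C ⥤ C') [PreservesFiniteColimits A]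
    (X Y : C) : A.obj X ⨿ A.obj Y ≅ A.obj (X ⨿ Y) :=
  PreservesColimitPair.iso A X Y

section
variable [HasFiniteColimits C] [HasFiniteColimits C'] (A : C ⥤ C') [PreservesFiniteColimits A]

lemma inl_kappa (X Y : C) : coprod.inl ≫ (kappa A X Y).hom = A.map coprod.inl := by
  simp [kappa]

lemma inr_kappa (X Y : C) : coprod.inr ≫ (kappa A X Y).hom = A.map coprod.inr := by
  simp [kappa]

/-- The comparison `⊥ ≅ A ⊥`, for `A` preserving finite colimits. -/
def kappaUnit : ⊥_ C' ≅ A.obj (⊥_ C) := (PreservesInitial.iso A).symm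

attribute [local simp] inl_kappa inr_kappa

lemma inl_kappa_assoc {X Y : C} {Z : C'} (f : A.obj (X ⨿ Y) ⟶ Z) :
    coprod.inl ≫ (kappa A X Y).hom ≫ f = A.map coprod.inl ≫ f := by
  rw [← Category.assoc, inl_kappa]

lemma inr_kappa_assoc {X Y : C} {Z : C'} (f : A.obj (X ⨿ Y) ⟶ Z) :
    coprod.inr ≫ (kappa A X Y).hom ≫ f = A.map coprod.inr ≫ f := by
  rw [← Category.assoc, inr_kappa]

attribute [local simp] inl_kappa_assoc inr_kappa_assoc

lemma map_kappa {X Y X' Y' : C} (f : X ⟶ Y) (g : X' ⟶ Y') :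
    coprod.map (A.map f) (A.map g) ≫ (kappa A Y Y').hom =
      (kappa A X X').hom ≫ A.map (coprod.map f g) := by
  apply coprod.hom_ext <;> simp [← Functor.map_comp]

lemma kappa_assoc (X Y Z : C) :
    coprod.map (kappa A X Y).hom (𝟙 (A.obj Z)) ≫ (kappa A (X ⨿ Y) Z).hom ≫
        A.map (coprod.associator X Y Z).hom =
      (coprod.associator (A.obj X) (A.obj Y) (A.obj Z)).hom ≫
        coprod.map (𝟙 (A.obj X)) (kappa A Y Z).hom ≫ (kappa A X (Y ⨿ Z)).hom := by
  apply coprod.hom_ext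
  · apply coprod.hom_ext <;> simp [← Functor.map_comp]
  · simp [← Functor.map_comp]

lemma kappa_left (X : C) :
    (coprod.leftUnitor (A.obj X)).hom = coprod.map (kappaUnit A).hom (𝟙 (A.obj X)) ≫
      (kappa A (⊥_ C) X).hom ≫ A.map (coprod.leftUnitor X).hom := by
  apply coprod.hom_ext
  · exact Subsingleton.elim _ _
  · simp [← Functor.map_comp]

lemma kappa_right (X : C) :
    (coprod.rightUnitor (A.obj X)).hom = coprod.map (𝟙 (A.obj X)) (kappaUnit A).hom ≫
      (kappa A X (⊥_ C)).hom ≫ A.map (coprod.rightUnitor X).hom := by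
  apply coprod.hom_ext
  · simp [← Functor.map_comp]
  · exact Subsingleton.elim _ _

lemma kappa_braiding (X Y : C) :
    (kappa A X Y).hom ≫ A.map (coprod.braiding X Y).hom =
      (coprod.braiding (A.obj X) (A.obj Y)).hom ≫ (kappa A Y X).hom := by
  apply coprod.hom_ext <;> simp [← Functor.map_comp]

end

namespace AdjoinOp

variable {M : MorphismProperty C} {M' : MorphismProperty C'}
  [HasFiniteColimits C] [M.IsMultiplicative] [M.IsStableUnderCobaseChange]
  [HasFiniteColimits C'] [M'.IsMultiplicative] [M'.IsStableUnderCobaseChange]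

/-- The extension of `A : C ⥤ C'` to a functor `C ; Mᵒᵖ ⥤ C' ; M'ᵒᵖ`, applying `A` to cospans. -/
def extend (A : C ⥤ C') [PreservesFiniteColimits A] (hA : M ≤ M'.inverseImage A) :
    AdjoinOp M ⥤ AdjoinOp M' where
  obj X := ⟨A.obj X.of⟩
  map {X Y} f := Quotient.map (sa := homSetoid M X.of Y.of)
    (sb := homSetoid M' (A.obj X.of) (A.obj Y.of))
    (fun a => ⟨a.1.map A, hA _ a.2⟩) (fun _ _ h => Csp.Rel.map A h) f
  map_id X := sound (X := ⟨A.obj X.of⟩) (Y := ⟨A.obj X.of⟩)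
    (a := (Csp.ofHom (𝟙 X.of)).map A) (b := Csp.ofHom (𝟙 (A.obj X.of)))
    (DCsp.mkRel (Iso.refl _) (by simp [Csp.ofHom]) (by simp [Csp.ofHom]) rfl)
  map_comp {X Y Z} f g := ind (fun a _ => ind (fun b _ =>
    (sound (X := ⟨A.obj X.of⟩) (Y := ⟨A.obj Z.of⟩) (a := (a.map A).comp (b.map A))
      (b := (a.comp b).map A)
      (DCsp.IsComp.comp_rel (a := (a.map A).toD) (b := (b.map A).toD)
        (c := ((a.comp b).map A).toD) (DCsp.mkComp _ _ ((IsPushout.of_hasPushout a.o b.i).map A)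
          (A.map_comp _ _).symm (A.map_comp _ _).symm rfl))).symm) g) f

variable (A : C ⥤ C') [PreservesFiniteColimits A] (hA : M ≤ M'.inverseImage A)

lemma extend_ofHom {X Y : C} (f : X ⟶ Y) :
    (extend A hA).map (ofHom f) = ofHom (A.map f) :=
  sound (X := ⟨A.obj X⟩) (Y := ⟨A.obj Y⟩) (a := (Csp.ofHom f).map A) (b := Csp.ofHom (A.map f))
    (DCsp.mkRel (Iso.refl _) (by simp [Csp.ofHom]) (by simp [Csp.ofHom]) rfl)

lemma extend_tensor {X Y X' Y' : AdjoinOp M} (f : X ⟶ Y) (g : X' ⟶ Y') :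
    tensorHom ((extend A hA).map f) ((extend A hA).map g) ≫ ofHom (kappa A Y.of Y'.of).hom =
      ofHom (kappa A X.of X'.of).hom ≫ (extend A hA).map (tensorHom f g) :=
  ind (fun a _ => ind (fun b _ => sound (X := ⟨A.obj X.of ⨿ A.obj X'.of⟩)
    (Y := ⟨A.obj (Y.of ⨿ Y'.of)⟩)
    (a := ((a.map A).tensor (b.map A)).comp (Csp.ofHom (kappa A Y.of Y'.of).hom))
    (b := (Csp.ofHom (kappa A X.of X'.of).hom).comp ((a.tensor b).map A))
    (DCsp.natural (s := (1 : PUnit)) (s' := (1 : PUnit)) _ _ (kappa A a.apex b.apex) (map_kappa A _ _) (map_kappa A _ _) rfl)) g) f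

/-- The structure maps making `extend A hA` a strong monoidal functor: the comparison maps
`A X ⨿ A Y ≅ A (X ⨿ Y)` and `⊥ ≅ A ⊥`. -/
def extendCore : (extend A hA).CoreMonoidal where
  εIso := isoOf (kappaUnit A)
  μIso X Y := isoOf (kappa A X.of Y.of)
  μIso_hom_natural_left {X Y} f X' := by
    have h := extend_tensor A hA f (𝟙 X')
    rw [CategoryTheory.Functor.map_id] at h
    exact h
  μIso_hom_natural_right {X Y} X' f := by
    have h := extend_tensor A hA (𝟙 X') f
    rw [CategoryTheory.Functor.map_id] at h
    exact h
  associativity X Y Z := by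
    have h := congrArg (ofHom (M := M')) (kappa_assoc A X.of Y.of Z.of)
    simp only [ofHom_comp, ← ofHom_tensor, ← extend_ofHom A hA] at h
    exact h
  left_unitality X := by
    have h := congrArg (ofHom (M := M')) (kappa_left A X.of)
    simp only [ofHom_comp, ← ofHom_tensor, ← extend_ofHom A hA] at h
    exact h
  right_unitality X := by
    have h := congrArg (ofHom (M := M')) (kappa_right A X.of)
    simp only [ofHom_comp, ← ofHom_tensor, ← extend_ofHom A hA] at h
    exact h

instance : (extend A hA).Braided where
  __ := (extendCore A hA).toMonoidal
  braided X Y := by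
    have h := congrArg (ofHom (M := M')) (kappa_braiding A X.of Y.of)
    simp only [ofHom_comp, ← extend_ofHom A hA] at h
    exact h

end AdjoinOp
end MapAdjoinOp

section Decorations

variable {C : Type u} [Category.{v} C]

/-- A factorisation system `(E, M)` on `C`: subcategories `E` and `M` containing all isomorphisms,
such that every morphism factors as a morphism of `E` followed by one of `M`, functorially in a
unique way. -/
structure FactorizationSystem (C : Type u) [Category.{v} C] where
  E : MorphismProperty C
  M : MorphismProperty C
  [isMultiplicative_E : E.IsMultiplicative]
  [isMultiplicative_M : M.IsMultiplicative]
  iso_mem_E : ∀ {X Y : C} (f : X ⟶ Y) [IsIso f], E f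
  iso_mem_M : ∀ {X Y : C} (f : X ⟶ Y) [IsIso f], M f
  exists_fac : ∀ {X Y : C} (f : X ⟶ Y), ∃ (N : C) (e : X ⟶ N) (m : N ⟶ Y), E e ∧ M m ∧ e ≫ m = f
  existsUnique_lift : ∀ {X N Y X' N' Y' : C} (e : X ⟶ N) (m : N ⟶ Y) (e' : X' ⟶ N') (m' : N' ⟶ Y')
    (u : X ⟶ X') (v : Y ⟶ Y'), E e → M m → E e' → M m' → u ≫ e' ≫ m' = (e ≫ m) ≫ v →
      ∃! s : N ⟶ N', e ≫ s = u ≫ e' ∧ s ≫ m' = m ≫ v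

attribute [instance] FactorizationSystem.isMultiplicative_E FactorizationSystem.isMultiplicative_M

namespace FactorizationSystem

variable (S : FactorizationSystem C)

/-- The object through which `f` factors. -/
def mid {X Y : C} (f : X ⟶ Y) : C := (S.exists_fac f).choose

/-- The `E`-factor of `f`. -/
def e {X Y : C} (f : X ⟶ Y) : X ⟶ S.mid f := (S.exists_fac f).choose_spec.choose

/-- The `M`-factor of `f`. -/
def m {X Y : C} (f : X ⟶ Y) : S.mid f ⟶ Y := (S.exists_fac f).choose_spec.choose_spec.choose

lemma e_mem {X Y : C} (f : X ⟶ Y) : S.E (S.e f) :=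
  (S.exists_fac f).choose_spec.choose_spec.choose_spec.1

lemma m_mem {X Y : C} (f : X ⟶ Y) : S.M (S.m f) :=
  (S.exists_fac f).choose_spec.choose_spec.choose_spec.2.1

lemma e_m {X Y : C} (f : X ⟶ Y) : S.e f ≫ S.m f = f :=
  (S.exists_fac f).choose_spec.choose_spec.choose_spec.2.2

variable {S}

lemma exists_iso {X N N' Y : C} {e : X ⟶ N} {m : N ⟶ Y} {e' : X ⟶ N'} {m' : N' ⟶ Y}
    (he : S.E e) (hm : S.M m) (he' : S.E e') (hm' : S.M m') (h : e ≫ m = e' ≫ m') :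
    ∃ n : N ≅ N', e ≫ n.hom = e' ∧ n.hom ≫ m' = m := by
  obtain ⟨s, ⟨hs1, hs2⟩, -⟩ := S.existsUnique_lift e m e' m' (𝟙 X) (𝟙 Y) he hm he' hm' (by simp [h])
  obtain ⟨t, ⟨ht1, ht2⟩, -⟩ := S.existsUnique_lift e' m' e m (𝟙 X) (𝟙 Y) he' hm' he hm (by simp [h])
  simp only [Category.id_comp, Category.comp_id] at hs1 hs2 ht1 ht2
  refine ⟨⟨s, t, ?_, ?_⟩, hs1, hs2⟩
  · exact (S.existsUnique_lift e m e m (𝟙 X) (𝟙 Y) he hm he hm (by simp)).unique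
      ⟨by simp [← Category.assoc, hs1, ht1], by simp [hs2, ht2]⟩ ⟨by simp, by simp⟩
  · exact (S.existsUnique_lift e' m' e' m' (𝟙 X) (𝟙 Y) he' hm' he' hm' (by simp)).unique
      ⟨by simp [← Category.assoc, hs1, ht1], by simp [hs2, ht2]⟩ ⟨by simp, by simp⟩

lemma coprod_map_mem_E [HasFiniteColimits C] {X Y X' Y' : C} {f : X ⟶ Y} {g : X' ⟶ Y'}
    (hf : S.E f) (hg : S.E g) : S.E (coprod.map f g) := by
  let e := S.e (coprod.map f g)
  let m := S.m (coprod.map f g)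
  have hem : e ≫ m = coprod.map f g := S.e_m _
  have he : S.E e := S.e_mem _
  have hm : S.M m := S.m_mem _
  obtain ⟨x, ⟨hx1, hx2⟩, -⟩ := S.existsUnique_lift f (𝟙 Y) e m coprod.inl coprod.inl hf
    (S.iso_mem_M _) he hm (by simp [hem])
  obtain ⟨y, ⟨hy1, hy2⟩, -⟩ := S.existsUnique_lift g (𝟙 Y') e m coprod.inr coprod.inr hg
    (S.iso_mem_M _) he hm (by simp [hem])
  have h1 : coprod.map f g ≫ coprod.desc x y = e := by
    apply coprod.hom_ext <;> simp [hx1, hy1]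
  have h2 : coprod.desc x y ≫ m = 𝟙 _ := by
    apply coprod.hom_ext
    · simpa using hx2
    · simpa using hy2
  have h3 : m ≫ coprod.desc x y = 𝟙 _ :=
    (S.existsUnique_lift e m e m (𝟙 _) (𝟙 _) he hm he hm (by simp)).unique
      ⟨by rw [← Category.assoc, hem, h1, Category.id_comp], by rw [Category.assoc, h2]⟩
      ⟨by simp, by simp⟩
  have : IsIso m := ⟨_, h3, h2⟩
  rw [← hem]
  exact S.E.comp_mem _ _ he (S.iso_mem_E m)

end FactorizationSystem

variable [HasFiniteColimits C] {M : MorphismProperty C} [M.IsMultiplicative]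
  [M.IsStableUnderCobaseChange]

lemma AdjoinOp.beck_chevalley {X Y Z P : C} {f : X ⟶ Y} {g : X ⟶ Z} {j : Y ⟶ P} {k : Z ⟶ P}
    (s : IsPushout f g j k) (hf : M f) (hk : M k) :
    opHom f hf ≫ ofHom g = ofHom j ≫ opHom k hk :=
  (AdjoinOp.sound (X := ⟨Y⟩) (Y := ⟨Z⟩) (a := (Csp.opHom f).comp (Csp.ofHom g)) (b := ⟨P, j, k⟩)
    (h' := hk) (DCsp.opHom_comp_ofHom s)).trans
  (AdjoinOp.sound (X := ⟨Y⟩) (Y := ⟨Z⟩) (a := (Csp.ofHom j).comp (Csp.opHom k)) (b := ⟨P, j, k⟩)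
    (DCsp.ofHom_comp_opHom j k)).symm

lemma AdjoinOp.ofHom_iso {X Y : C} (f : X ≅ Y) (h : M f.inv) :
    (ofHom f.hom : (⟨X⟩ : AdjoinOp M) ⟶ _) = opHom f.inv h :=
  AdjoinOp.sound (X := ⟨X⟩) (Y := ⟨Y⟩) (a := Csp.ofHom f.hom) (b := Csp.opHom f.inv)
    (DCsp.ofHom_rel_opHom f)

lemma AdjoinOp.opHom_tensor {X Y X' Y' : C} (f : X ⟶ Y) (g : X' ⟶ Y') (hf : M f) (hg : M g) :
    opHom f hf ⊗ₘ opHom g hg = opHom (coprod.map f g) (coprod_map_mem hf hg) :=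
  sound (M := M) (X := ⟨Y ⨿ Y'⟩) (Y := ⟨X ⨿ X'⟩) (a := (Csp.opHom f).tensor (Csp.opHom g))
    (b := Csp.opHom (coprod.map f g)) (DCsp.Rel.of_eq (DCsp.opHom_tensor f g))

namespace Decoration

variable (F : AdjoinOp M ⥤ Type w)

/-- The action of `F` on a morphism of `C`. -/
def push {X Y : C} (f : X ⟶ Y) (s : F.obj ⟨X⟩) : F.obj ⟨Y⟩ := F.map (AdjoinOp.ofHom f) s

/-- The action of `F` on the reverse of a morphism of `M`. -/
def pull {X Y : C} (m : X ⟶ Y) (hm : M m) (s : F.obj ⟨Y⟩) : F.obj ⟨X⟩ :=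
  F.map (AdjoinOp.opHom m hm) s

/-- The laxator `F X × F Y → F (X ⨿ Y)`. -/
def pair [F.LaxMonoidal] {X Y : C} (s : F.obj ⟨X⟩) (t : F.obj ⟨Y⟩) : F.obj ⟨X ⨿ Y⟩ :=
  Functor.LaxMonoidal.μ F ⟨X⟩ ⟨Y⟩ (s, t)

/-- The empty decoration on `N`: the image of the unit of `F` under `⊥ ⟶ N`. -/
def empty [F.LaxMonoidal] (N : C) : F.obj ⟨N⟩ :=
  push F (initial.to N) (Functor.LaxMonoidal.ε F PUnit.unit)

lemma congr_type {X Y : Type w} {f g : X ⟶ Y} (h : f = g) (x : X) : f x = g x := by rw [h]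

lemma push_id (X : C) (s : F.obj ⟨X⟩) : push F (𝟙 X) s = s := by
  simp [push, AdjoinOp.ofHom_id]

lemma push_push {X Y Z : C} (f : X ⟶ Y) (g : Y ⟶ Z) (s : F.obj ⟨X⟩) :
    push F g (push F f s) = push F (f ≫ g) s := by
  simp [push, AdjoinOp.ofHom_comp]

lemma pull_pull {X Y Z : C} (f : X ⟶ Y) (g : Y ⟶ Z) (hf : M f) (hg : M g) (s : F.obj ⟨Z⟩) :
    pull F f hf (pull F g hg s) = pull F (f ≫ g) (M.comp_mem _ _ hf hg) s := by
  simp [pull, AdjoinOp.opHom_comp f g hf hg]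

lemma push_iso {X Y : C} (f : X ≅ Y) (h : M f.inv) (s : F.obj ⟨X⟩) :
    push F f.hom s = pull F f.inv h s := by
  simp [push, pull, AdjoinOp.ofHom_iso f h]

lemma push_pull {X Y Z P : C} {f : X ⟶ Y} {g : X ⟶ Z} {j : Y ⟶ P} {k : Z ⟶ P}
    (sq : IsPushout f g j k) (hf : M f) (hk : M k) (s : F.obj ⟨Y⟩) :
    push F g (pull F f hf s) = pull F k hk (push F j s) := by
  have h := AdjoinOp.beck_chevalley sq hf hk
  simpa [push, pull] using congrArg (fun t => F.map t s) h

section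
variable [F.LaxMonoidal]
open Functor.LaxMonoidal

lemma push_pair {X Y X' Y' : C} (f : X ⟶ Y) (g : X' ⟶ Y') (s : F.obj ⟨X⟩) (t : F.obj ⟨X'⟩) :
    push F (coprod.map f g) (pair F s t) = pair F (push F f s) (push F g t) := by
  have h := μ_natural F (AdjoinOp.ofHom f) (AdjoinOp.ofHom (M := M) g)
  have h2 : (AdjoinOp.ofHom (M := M) f ⊗ₘ AdjoinOp.ofHom g) = AdjoinOp.ofHom (coprod.map f g) :=
    AdjoinOp.ofHom_tensor f g
  rw [h2] at h
  exact (congr_type h ((s, t) : _ × _)).symm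

lemma pull_pair {X Y X' Y' : C} (f : X ⟶ Y) (g : X' ⟶ Y') (hf : M f) (hg : M g) (s : F.obj ⟨Y⟩)
    (t : F.obj ⟨Y'⟩) : pull F (coprod.map f g) (AdjoinOp.coprod_map_mem hf hg) (pair F s t) =
      pair F (pull F f hf s) (pull F g hg t) := by
  have h := μ_natural F (AdjoinOp.opHom f hf) (AdjoinOp.opHom g hg)
  rw [AdjoinOp.opHom_tensor f g hf hg] at h
  exact (congr_type h ((s, t) : _ × _)).symm

lemma pair_assoc {X Y Z : C} (s : F.obj ⟨X⟩) (t : F.obj ⟨Y⟩) (r : F.obj ⟨Z⟩) :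
    push F (coprod.associator X Y Z).hom (pair F (pair F s t) r) = pair F s (pair F t r) :=
  congr_type (associativity F ⟨X⟩ ⟨Y⟩ ⟨Z⟩) (((s, t), r) : (_ × _) × _)

lemma pair_unit_left {X : C} (s : F.obj ⟨X⟩) :
    push F (coprod.leftUnitor X).hom (pair F (ε F PUnit.unit) s) = s :=
  (congr_type (left_unitality F ⟨X⟩) ((PUnit.unit, s) : PUnit × _)).symm

end

section
variable [F.LaxBraided]
open Functor.LaxMonoidal

lemma pair_comm {X Y : C} (s : F.obj ⟨X⟩) (t : F.obj ⟨Y⟩) :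
    push F (coprod.braiding X Y).hom (pair F s t) = pair F t s :=
  congr_type (Functor.LaxBraided.braided (F := F) ⟨X⟩ ⟨Y⟩) ((s, t) : _ × _)

/-- Auxiliary: the product of two decorations on `N`. -/
def mul {N : C} (s t : F.obj ⟨N⟩) : F.obj ⟨N⟩ := push F (coprod.desc (𝟙 N) (𝟙 N)) (pair F s t)

lemma push_mul_push {X Y Z : C} (f : X ⟶ Z) (g : Y ⟶ Z) (s : F.obj ⟨X⟩) (t : F.obj ⟨Y⟩) :
    mul F (push F f s) (push F g t) = push F (coprod.desc f g) (pair F s t) := by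
  rw [mul, ← push_pair, push_push]; congr 2; simp

lemma mul_comm' {N : C} (s t : F.obj ⟨N⟩) : mul F s t = mul F t s := by
  rw [mul, mul, ← pair_comm, push_push]; congr 2; simp

/-- Auxiliary: the commutative monoid of decorations on `N`. -/
@[reducible] def commMonoid (N : C) : CommMonoid (F.obj ⟨N⟩) :=
  have one_mul' : ∀ s, mul F (empty F N) s = s := fun s => by
    conv_lhs => rw [← push_id F _ s, empty]
    rw [push_mul_push]
    conv_rhs => rw [← pair_unit_left F s]
    rfl
  { mul := mul F
    one := empty F N
    mul_assoc := fun s t r => by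
      change mul F (mul F s t) r = mul F s (mul F t r)
      have h1 : mul F (mul F s t) r = mul F (push F (coprod.desc (𝟙 N) (𝟙 N)) (pair F s t))
        (push F (𝟙 N) r) := by rw [push_id]; rfl
      have h2 : mul F s (mul F t r) = mul F (push F (𝟙 N) s)
        (push F (coprod.desc (𝟙 N) (𝟙 N)) (pair F t r)) := by rw [push_id]; rfl
      rw [h1, h2, push_mul_push, push_mul_push, ← pair_assoc, push_push]
      congr 1
      apply coprod.hom_ext
      · apply coprod.hom_ext <;> simp
      · simp
    one_mul := one_mul'
    mul_one := fun s => (mul_comm' F s _).trans (one_mul' s)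
    mul_comm := mul_comm' F }

/-- Auxiliary: `F` restricted to `C`, as a functor to commutative monoids. -/
def mon : MonDecor.{w} C where
  obj N := F.obj ⟨N⟩
  mon N := commMonoid F N
  push {X Y} f :=
    letI := commMonoid F X
    letI := commMonoid F Y
    { toFun := push F f
      map_one' := by
        change push F f (push F _ _) = push F _ _
        rw [push_push]
        congr 1; exact Subsingleton.elim _ _
      map_mul' := fun s t => by
        change push F f (push F _ (pair F s t)) = mul F (push F f s) (push F f t)
        rw [push_mul_push, push_push]; congr 2; simp }
  push_id X s := push_id F X s
  push_push f g s := push_push F f g s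

lemma mon_push_mul_push {X Y Z : C} (f : X ⟶ Z) (g : Y ⟶ Z) (s : F.obj ⟨X⟩) (t : F.obj ⟨Y⟩) :
    (HMul.hMul (α := (mon F).obj Z) ((mon F).push f s) ((mon F).push g t)) =
      push F (coprod.desc f g) (pair F s t) :=
  push_mul_push F f g s t

end
end Decoration
end Decorations

section DecoratedCorelations

variable {C : Type u} [Category.{v} C] [HasFiniteColimits C] {S : FactorizationSystem C}
  [S.M.IsStableUnderCobaseChange]

/-- An `F`-decorated cospan: a cospan with an element of the `F`-image of its apex. -/
structure DecCsp (F : AdjoinOp S.M ⥤ Type w) (X Y : C) extends Csp X Y where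
  dec : F.obj ⟨apex⟩

namespace DecCsp

open Decoration

variable {F : AdjoinOp S.M ⥤ Type w}

/-- Isomorphism of decorated cospans with the same feet. -/
def Rel {X Y : C} (a b : DecCsp F X Y) : Prop :=
  ∃ n : a.apex ≅ b.apex, a.i ≫ n.hom = b.i ∧ a.o ≫ n.hom = b.o ∧ push F n.hom a.dec = b.dec

/-- A cospan is jointly `E`-like if the copairing of its legs lies in `E`. A decorated corelation is
a decorated cospan with this property. -/
def JointlyE {X Y : C} (a : DecCsp F X Y) : Prop := S.E (coprod.desc a.i a.o)

/-- The `E`-part of a decorated cospan, with the restricted decoration. -/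
def ePart {X Y : C} (a : DecCsp F X Y) : DecCsp F X Y where
  apex := S.mid (coprod.desc a.i a.o)
  i := coprod.inl ≫ S.e (coprod.desc a.i a.o)
  o := coprod.inr ≫ S.e (coprod.desc a.i a.o)
  dec := pull F (S.m (coprod.desc a.i a.o)) (S.m_mem _) a.dec

lemma jointlyE_ePart {X Y : C} (a : DecCsp F X Y) : a.ePart.JointlyE := by
  have h : coprod.desc a.ePart.i a.ePart.o = S.e (coprod.desc a.i a.o) := by
    apply coprod.hom_ext
    · exact coprod.inl_desc _ _
    · exact coprod.inr_desc _ _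
  rw [JointlyE, h]
  exact S.e_mem _

variable [F.LaxBraided]

/-- A cospan with the empty decoration. -/
def emptyDec {X Y : C} (a : Csp X Y) : DecCsp F X Y := ⟨a, empty F a.apex⟩

/-- Composition of decorated cospans: the pushout of cospans, with the image of the pair of
decorations under the copairing of the pushout maps. -/
def comp {X Y Z : C} (a : DecCsp F X Y) (b : DecCsp F Y Z) : DecCsp F X Z where
  toCsp := a.toCsp.comp b.toCsp
  dec := push F (coprod.desc (pushout.inl a.o b.i) (pushout.inr a.o b.i)) (pair F a.dec b.dec)

/-- The monoidal product of decorated cospans. -/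
def tensor {X Y X' Y' : C} (a : DecCsp F X Y) (b : DecCsp F X' Y') :
    DecCsp F (X ⨿ X') (Y ⨿ Y') where
  toCsp := a.toCsp.tensor b.toCsp
  dec := pair F a.dec b.dec

lemma JointlyE.tensor {X Y X' Y' : C} {a : DecCsp F X Y} {b : DecCsp F X' Y'} (ha : a.JointlyE)
    (hb : b.JointlyE) : (a.tensor b).JointlyE := by
  let n : (X ⨿ X') ⨿ (Y ⨿ Y') ≅ (X ⨿ Y) ⨿ (X' ⨿ Y') :=
    { hom := coprod.desc (coprod.map coprod.inl coprod.inl) (coprod.map coprod.inr coprod.inr)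
      inv := coprod.desc (coprod.map coprod.inl coprod.inl) (coprod.map coprod.inr coprod.inr)
      hom_inv_id := by apply coprod.hom_ext <;> apply coprod.hom_ext <;> simp
      inv_hom_id := by apply coprod.hom_ext <;> apply coprod.hom_ext <;> simp }
  have h : coprod.desc (coprod.map a.i b.i) (coprod.map a.o b.o) =
      n.hom ≫ coprod.map (coprod.desc a.i a.o) (coprod.desc b.i b.o) := by
    apply coprod.hom_ext <;> simp [n]
  change S.E (coprod.desc (coprod.map a.i b.i) (coprod.map a.o b.o))
  rw [h]
  have : IsIso n.hom := n.isIso_hom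
  exact S.E.comp_mem _ _ (S.iso_mem_E n.hom) (FactorizationSystem.coprod_map_mem_E ha hb)

/-! Auxiliary: transfer from cospans decorated by commutative monoids. -/

abbrev toD {X Y : C} (a : DecCsp F X Y) : DCsp (mon F) X Y := ⟨a.toCsp, a.dec⟩

abbrev ofD {X Y : C} (a : DCsp (mon F) X Y) : DecCsp F X Y := ⟨a.toCsp, a.dec⟩

lemma ofD_comp {X Y Z : C} (a : DecCsp F X Y) (b : DecCsp F Y Z) :
    ofD (a.toD.comp b.toD) = a.comp b :=
  congrArg (DecCsp.mk (a.toCsp.comp b.toCsp)) (push_mul_push F _ _ _ _)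

lemma ofD_tensor {X Y X' Y' : C} (a : DecCsp F X Y) (b : DecCsp F X' Y') :
    ofD (a.toD.tensor b.toD) = a.tensor b :=
  congrArg (DecCsp.mk (a.toCsp.tensor b.toCsp))
    ((push_mul_push F _ _ _ _).trans (by rw [coprod.desc_inl_inr, push_id]))

lemma comp_congr {X Y Z : C} {a a' : DecCsp F X Y} {b b' : DecCsp F Y Z} (h : Rel a a')
    (h' : Rel b b') : Rel (a.comp b) (a'.comp b') := by
  rw [← ofD_comp, ← ofD_comp]
  exact DCsp.comp_congr (a := a.toD) (a' := a'.toD) (b := b.toD) (b' := b'.toD) h h'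

lemma tensor_congr {X Y X' Y' : C} {a a' : DecCsp F X Y} {b b' : DecCsp F X' Y'} (h : Rel a a')
    (h' : Rel b b') : Rel (a.tensor b) (a'.tensor b') := by
  rw [← ofD_tensor, ← ofD_tensor]
  exact DCsp.tensor_congr (a := a.toD) (a' := a'.toD) (b := b.toD) (b' := b'.toD) h h'

lemma rel_equivalence (X Y : C) : Equivalence (Rel (F := F) (X := X) (Y := Y)) where
  refl a := DCsp.Rel.refl a.toD
  symm {a b} h := DCsp.Rel.symm (a := a.toD) (b := b.toD) h
  trans {a b c} h h' := DCsp.Rel.trans (a := a.toD) (b := b.toD) (c := c.toD) h h'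

/-- `b` is the restriction of `a` along a morphism of `M` between the apices. -/
def Res {X Y : C} (a b : DecCsp F X Y) : Prop :=
  ∃ (m : b.apex ⟶ a.apex) (hm : S.M m), b.i ≫ m = a.i ∧ b.o ≫ m = a.o ∧ pull F m hm a.dec = b.dec

lemma Rel.res {X Y : C} {a b : DecCsp F X Y} : Rel a b → Res a b := by
  rintro ⟨n, h1, h2, h3⟩
  refine ⟨n.inv, S.iso_mem_M _, by simp [← h1], by simp [← h2], ?_⟩
  rw [← h3, push_iso F n (S.iso_mem_M _)]

lemma Res.refl {X Y : C} (a : DecCsp F X Y) : Res a a := ((rel_equivalence X Y).refl a).res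

lemma Res.trans {X Y : C} {a b c : DecCsp F X Y} : Res a b → Res b c → Res a c := by
  rintro ⟨m, hm, h1, h2, h3⟩ ⟨m', hm', k1, k2, k3⟩
  refine ⟨m' ≫ m, S.M.comp_mem _ _ hm' hm, ?_, ?_, ?_⟩
  · rw [← Category.assoc, k1, h1]
  · rw [← Category.assoc, k2, h2]
  · rw [← pull_pull F m' m hm' hm, h3, k3]

lemma res_ePart {X Y : C} (a : DecCsp F X Y) : Res a a.ePart := by
  refine ⟨S.m (coprod.desc a.i a.o), S.m_mem _, ?_, ?_, rfl⟩
  · change (coprod.inl ≫ S.e _) ≫ S.m _ = _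
    rw [Category.assoc, S.e_m, coprod.inl_desc]
  · change (coprod.inr ≫ S.e _) ≫ S.m _ = _
    rw [Category.assoc, S.e_m, coprod.inr_desc]

lemma Res.rel {X Y : C} {a b c : DecCsp F X Y} (hb : b.JointlyE) (hc : c.JointlyE) :
    Res a b → Res a c → Rel b c := by
  rintro ⟨m, hm, h1, h2, h3⟩ ⟨m', hm', k1, k2, k3⟩
  obtain ⟨n, hn1, hn2⟩ := FactorizationSystem.exists_iso hb hm hc hm'
    (by apply coprod.hom_ext <;> simp [h1, h2, k1, k2])
  refine ⟨n, ?_, ?_, ?_⟩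
  · simpa using coprod.inl ≫= hn1
  · simpa using coprod.inr ≫= hn1
  · have hn3 : n.inv ≫ m = m' := by rw [← hn2, Iso.inv_hom_id_assoc]
    subst hn3
    rw [← k3, ← h3, push_iso F n (S.iso_mem_M _), pull_pull]

lemma isPushout_restrict {N N' Y L L' P Q : C} {f : Y ⟶ N} {g : Y ⟶ L} {j : N ⟶ P} {k : L ⟶ P}
    (s : IsPushout f g j k) {m : N ⟶ N'} {m' : L ⟶ L'} {J : N' ⟶ Q} {K : L' ⟶ Q}
    (t : IsPushout (f ≫ m) (g ≫ m') J K) {d : P ⟶ Q} (h1 : j ≫ d = m ≫ J) (h2 : k ≫ d = m' ≫ K) :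
    IsPushout (coprod.map m m') (coprod.desc j k) (coprod.desc J K) d := by
  refine DCsp.isPushout_of (by simp [h1, h2]) (fun T p q w => ?_) (fun T e e' w1 w2 => ?_)
  · have w1 : m ≫ coprod.inl ≫ p = j ≫ q := by simpa using coprod.inl ≫= w
    have w2 : m' ≫ coprod.inr ≫ p = k ≫ q := by simpa using coprod.inr ≫= w
    refine ⟨t.desc (coprod.inl ≫ p) (coprod.inr ≫ p) ?_, ?_, ?_⟩
    · rw [Category.assoc, Category.assoc, w1, w2, s.w_assoc]
    · apply coprod.hom_ext <;> simp
    · apply s.hom_ext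
      · rw [← Category.assoc, h1]; simp [w1]
      · rw [← Category.assoc, h2]; simp [w2]
  · apply t.hom_ext
    · simpa using coprod.inl ≫= w1
    · simpa using coprod.inr ≫= w1

lemma Res.comp {X Y Z : C} {a a' : DecCsp F X Y} {b b' : DecCsp F Y Z} :
    Res a a' → Res b b' → Res (a.comp b) (a'.comp b') := by
  rintro ⟨m, hm, h1, h2, h3⟩ ⟨m', hm', k1, k2, k3⟩
  have sq := IsPushout.of_hasPushout a'.o b'.i
  have sq' := IsPushout.of_hasPushout a.o b.i
  have hw : a'.o ≫ m ≫ pushout.inl a.o b.i = b'.i ≫ m' ≫ pushout.inr a.o b.i := by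
    rw [← Category.assoc, h2, ← Category.assoc, k1, sq'.w]
  have e1 := sq.inl_desc _ _ hw
  have e2 := sq.inr_desc _ _ hw
  have sq2 := isPushout_restrict sq (m := m) (m' := m') (by rw [h2, k1]; exact sq') e1 e2
  have hmm := AdjoinOp.coprod_map_mem hm hm'
  have hd : S.M (sq.desc _ _ hw) :=
    MorphismProperty.IsStableUnderCobaseChange.of_isPushout sq2.flip hmm
  have p1 : (a'.i ≫ pushout.inl a'.o b'.i) ≫ sq.desc _ _ hw = a.i ≫ pushout.inl a.o b.i := by
    rw [Category.assoc, e1, ← Category.assoc, h1]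
  have p2 : (b'.o ≫ pushout.inr a'.o b'.i) ≫ sq.desc _ _ hw = b.o ≫ pushout.inr a.o b.i := by
    rw [Category.assoc, e2, ← Category.assoc, k2]
  have p3 : pull F _ hd (push F (coprod.desc (pushout.inl a.o b.i) (pushout.inr a.o b.i))
        (pair F a.dec b.dec)) =
      push F (coprod.desc (pushout.inl a'.o b'.i) (pushout.inr a'.o b'.i))
        (pair F a'.dec b'.dec) := by
    rw [← h3, ← k3, ← pull_pair, push_pull F sq2 hmm hd]
  exact ⟨sq.desc _ _ hw, hd, p1, p2, p3⟩

lemma Res.tensor {X Y X' Y' : C} {a a' : DecCsp F X Y} {b b' : DecCsp F X' Y'} :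
    Res a a' → Res b b' → Res (a.tensor b) (a'.tensor b') := by
  rintro ⟨m, hm, h1, h2, h3⟩ ⟨m', hm', k1, k2, k3⟩
  refine ⟨coprod.map m m', AdjoinOp.coprod_map_mem hm hm', ?_, ?_, ?_⟩
  · change coprod.map _ _ ≫ coprod.map _ _ = coprod.map _ _
    rw [coprod.map_map, h1, k1]
  · change coprod.map _ _ ≫ coprod.map _ _ = coprod.map _ _
    rw [coprod.map_map, h2, k2]
  · change pull F _ _ (pair F _ _) = pair F _ _
    rw [pull_pair F m m' hm hm', h3, k3]

end DecCsp

/-- The objects of the category of `F`-decorated corelations: the objects of `C`. -/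
structure DecCorel (F : AdjoinOp S.M ⥤ Type w) where
  of : C

namespace DecCorel

variable {F : AdjoinOp S.M ⥤ Type w} [F.LaxBraided]

variable (F) in
/-- Decorated corelations up to isomorphism. -/
def homSetoid (X Y : C) : Setoid {a : DecCsp F X Y // a.JointlyE} where
  r a b := DecCsp.Rel a.1 b.1
  iseqv :=
    { refl := fun a => (DecCsp.rel_equivalence X Y).refl a.1
      symm := fun h => (DecCsp.rel_equivalence X Y).symm h
      trans := fun h h' => (DecCsp.rel_equivalence X Y).trans h h' }

/-- Morphisms of decorated corelation categories. -/
def Hom (X Y : DecCorel F) := Quotient (homSetoid F X.of Y.of)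

/-- The morphism represented by a decorated corelation. -/
def Hom.mk {X Y : DecCorel F} (a : DecCsp F X.of Y.of) (h : a.JointlyE) : Hom X Y :=
  Quotient.mk (homSetoid F X.of Y.of) ⟨a, h⟩

/-- The class of the `E`-part, with restricted decoration, of a decorated cospan. -/
def Hom.box {X Y : DecCorel F} (a : DecCsp F X.of Y.of) : Hom X Y :=
  Hom.mk a.ePart a.jointlyE_ePart

lemma Hom.mk_eq {X Y : DecCorel F} {a b : DecCsp F X.of Y.of} {ha : a.JointlyE} {hb : b.JointlyE}
    (h : DecCsp.Rel a b) : Hom.mk a ha = Hom.mk b hb :=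
  Quotient.sound (s := homSetoid F X.of Y.of) h

lemma Hom.box_eq_mk {X Y : DecCorel F} {a b : DecCsp F X.of Y.of} (h : DecCsp.Res a b)
    (hb : b.JointlyE) : Hom.box a = Hom.mk b hb :=
  Hom.mk_eq (DecCsp.Res.rel a.jointlyE_ePart hb a.res_ePart h)

lemma Hom.box_eq_of_res {X Y : DecCorel F} {a b : DecCsp F X.of Y.of} (h : DecCsp.Res a b) :
    Hom.box a = Hom.box b :=
  Hom.box_eq_mk (h.trans b.res_ePart) b.jointlyE_ePart

lemma Hom.sound {X Y : DecCorel F} {a b : DecCsp F X.of Y.of} (h : DecCsp.Rel a b) :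
    Hom.box a = Hom.box b :=
  Hom.box_eq_of_res h.res

/-- The composite of decorated corelations: the `E`-part of the composite decorated cospan, with
restricted decoration. -/
def Hom.comp {X Y Z : DecCorel F} (f : Hom X Y) (g : Hom Y Z) : Hom X Z :=
  Quotient.map₂ (sa := homSetoid F X.of Y.of) (sb := homSetoid F Y.of Z.of)
    (sc := homSetoid F X.of Z.of) (fun a b => ⟨(a.1.comp b.1).ePart, DecCsp.jointlyE_ePart _⟩)
    (fun _ _ h _ _ h' => Quotient.exact (s := homSetoid F X.of Z.of) (Hom.sound (X := X) (Y := Z)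
      (DecCsp.comp_congr h h'))) f g

/-- The monoidal product of decorated corelations: their monoidal product as decorated cospans. -/
def Hom.tensor {X Y X' Y' : DecCorel F} (f : Hom X Y) (g : Hom X' Y') :
    Hom (⟨X.of ⨿ X'.of⟩ : DecCorel F) ⟨Y.of ⨿ Y'.of⟩ :=
  Quotient.map₂ (sa := homSetoid F X.of Y.of) (sb := homSetoid F X'.of Y'.of)
    (sc := homSetoid F (X.of ⨿ X'.of) (Y.of ⨿ Y'.of))
    (fun a b => ⟨a.1.tensor b.1, a.2.tensor b.2⟩)
    (fun _ _ h _ _ h' => DecCsp.tensor_congr h h') f g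

@[elab_as_elim]
lemma Hom.ind {X Y : DecCorel F} {p : Hom X Y → Prop} (h : ∀ a, p (Hom.box a)) (f : Hom X Y) :
    p f :=
  Quotient.ind (fun a => by
    have e : Hom.box a.1 = Hom.mk a.1 a.2 := Hom.box_eq_mk (DecCsp.Res.refl a.1) a.2
    have h' := h a.1
    rw [e] at h'
    exact h') f

lemma Hom.box_comp {X Y Z : DecCorel F} (a : DecCsp F X.of Y.of) (b : DecCsp F Y.of Z.of) :
    Hom.comp (Hom.box a : Hom X Y) (Hom.box b : Hom Y Z) = Hom.box (a.comp b) :=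
  (Hom.box_eq_of_res (DecCsp.Res.comp a.res_ePart b.res_ePart)).symm

lemma Hom.box_tensor {X Y X' Y' : DecCorel F} (a : DecCsp F X.of Y.of) (b : DecCsp F X'.of Y'.of) :
    Hom.tensor (Hom.box a : Hom X Y) (Hom.box b : Hom X' Y') = Hom.box (a.tensor b) :=
  (Hom.box_eq_mk (X := ⟨X.of ⨿ X'.of⟩) (Y := ⟨Y.of ⨿ Y'.of⟩)
    (DecCsp.Res.tensor a.res_ePart b.res_ePart) _).symm

end DecCorel
end DecoratedCorelations

section DecCorelCategory

variable {C : Type u} [Category.{v} C] [HasFiniteColimits C] {S : FactorizationSystem C}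
  [S.M.IsStableUnderCobaseChange] {F : AdjoinOp S.M ⥤ Type w} [F.LaxBraided]

namespace DecCorel

open DecCsp Decoration

lemma Hom.ofD_sound {X Y : DecCorel F} {a b : DCsp (mon F) X.of Y.of} (h : DCsp.Rel a b) :
    (Hom.box (ofD a) : Hom X Y) = Hom.box (ofD b) := Hom.sound h

lemma Hom.ofD_box_comp {X Y Z : DecCorel F} (a : DCsp (mon F) X.of Y.of)
    (b : DCsp (mon F) Y.of Z.of) :
    Hom.comp (Hom.box (ofD a) : Hom X Y) (Hom.box (ofD b) : Hom Y Z) = Hom.box (ofD (a.comp b)) :=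
  (Hom.box_comp _ _).trans (congrArg Hom.box (ofD_comp (ofD a) (ofD b)).symm)

lemma Hom.ofD_box_tensor {X Y X' Y' : DecCorel F} (a : DCsp (mon F) X.of Y.of)
    (b : DCsp (mon F) X'.of Y'.of) :
    Hom.tensor (Hom.box (ofD a) : Hom X Y) (Hom.box (ofD b) : Hom X' Y') =
      Hom.box (ofD (a.tensor b)) :=
  (Hom.box_tensor _ _).trans (congrArg Hom.box (ofD_tensor (ofD a) (ofD b)).symm)

@[elab_as_elim]
lemma Hom.ofD_ind {X Y : DecCorel F} {p : Hom X Y → Prop}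
    (h : ∀ a : DCsp (mon F) X.of Y.of, p (Hom.box (ofD a))) (f : Hom X Y) : p f :=
  Hom.ind (fun a => h a.toD) f

/-- The category of `F`-decorated corelations. The identities are the identity cospans with the
empty decoration (replaced by their `E`-parts). -/
instance : Category (DecCorel F) where
  Hom X Y := Hom X Y
  id X := Hom.box (emptyDec (Csp.ofHom (𝟙 X.of)))
  comp f g := Hom.comp f g
  id_comp {X Y} f := Hom.ofD_ind (fun a => (Hom.ofD_box_comp (DCsp.ofHom (𝟙 X.of)) a).trans
    (Hom.ofD_sound (DCsp.id_comp a))) f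
  comp_id {X Y} f := Hom.ofD_ind (fun a => (Hom.ofD_box_comp a (DCsp.ofHom (𝟙 Y.of))).trans
    (Hom.ofD_sound (DCsp.comp_id a))) f
  assoc f g h := Hom.ofD_ind (fun a => Hom.ofD_ind (fun b => Hom.ofD_ind (fun c => by
    rw [Hom.ofD_box_comp, Hom.ofD_box_comp, Hom.ofD_box_comp, Hom.ofD_box_comp]
    exact Hom.ofD_sound (DCsp.comp_assoc a b c)) h) g) f

/-- The morphism of decorated corelation categories given by the `E`-part of a decorated cospan,
with restricted decoration. -/
def box {X Y : DecCorel F} (a : DecCsp F X.of Y.of) : X ⟶ Y := Hom.box a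

/-- The morphism of decorated corelation categories represented by a decorated corelation. -/
def homMk {X Y : DecCorel F} (a : DecCsp F X.of Y.of) (h : a.JointlyE) : X ⟶ Y := Hom.mk a h

/-- Auxiliary form of `box`. -/
def dbox {X Y : DecCorel F} (a : DCsp (mon F) X.of Y.of) : X ⟶ Y := box (ofD a)

lemma sound {X Y : DecCorel F} {a b : DCsp (mon F) X.of Y.of} (h : DCsp.Rel a b) :
    (dbox a : X ⟶ Y) = dbox b := Hom.ofD_sound h

@[elab_as_elim]
lemma ind {X Y : DecCorel F} {p : (X ⟶ Y) → Prop}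
    (h : ∀ a : DCsp (mon F) X.of Y.of, p (dbox a)) (f : X ⟶ Y) : p f := Hom.ofD_ind h f

lemma dbox_comp {X Y Z : DecCorel F} (a : DCsp (mon F) X.of Y.of) (b : DCsp (mon F) Y.of Z.of) :
    (dbox a : X ⟶ Y) ≫ (dbox b : Y ⟶ Z) = dbox (a.comp b) := Hom.ofD_box_comp a b

lemma sound₂ {X Y Y' Z : DecCorel F} {a : DCsp (mon F) X.of Y.of} {b : DCsp (mon F) Y.of Z.of}
    {a' : DCsp (mon F) X.of Y'.of} {b' : DCsp (mon F) Y'.of Z.of}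
    (h : DCsp.Rel (a.comp b) (a'.comp b')) :
    (dbox a : X ⟶ Y) ≫ (dbox b : Y ⟶ Z) = (dbox a' : X ⟶ Y') ≫ (dbox b' : Y' ⟶ Z) := by
  rw [dbox_comp, dbox_comp]; exact sound h

/-- A morphism `f` of `C`, as a cospan `X ⟶ Y = Y` with empty decoration, replaced by its
`E`-part. -/
def ofHom {X Y : C} (f : X ⟶ Y) : (⟨X⟩ : DecCorel F) ⟶ ⟨Y⟩ := box (emptyDec (Csp.ofHom f))

/-- A morphism `f` of `C`, as a cospan `Y = Y ⟵ X` with empty decoration, replaced by its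
`E`-part. -/
def opHom {X Y : C} (f : X ⟶ Y) : (⟨Y⟩ : DecCorel F) ⟶ ⟨X⟩ := box (emptyDec (Csp.opHom f))

lemma ofHom_eq {X Y : C} (f : X ⟶ Y) :
    (ofHom f : (⟨X⟩ : DecCorel F) ⟶ ⟨Y⟩) = dbox (DCsp.ofHom f) := rfl

lemma opHom_eq {X Y : C} (f : X ⟶ Y) :
    (opHom f : (⟨Y⟩ : DecCorel F) ⟶ ⟨X⟩) = dbox (DCsp.opHom f) := rfl

lemma ofHom_id (X : C) : (ofHom (𝟙 X) : (⟨X⟩ : DecCorel F) ⟶ ⟨X⟩) = 𝟙 _ := rfl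

lemma ofHom_comp {X Y Z : C} (f : X ⟶ Y) (g : Y ⟶ Z) :
    (ofHom (f ≫ g) : (⟨X⟩ : DecCorel F) ⟶ _) = ofHom f ≫ ofHom g := by
  rw [ofHom_eq, ofHom_eq, ofHom_eq]
  exact ((dbox_comp (X := ⟨X⟩) (Y := ⟨Y⟩) (Z := ⟨Z⟩) _ _).trans
    (sound (DCsp.ofHom_comp_ofHom f g))).symm

lemma opHom_comp {X Y Z : C} (f : X ⟶ Y) (g : Y ⟶ Z) :
    (opHom (f ≫ g) : (⟨Z⟩ : DecCorel F) ⟶ _) = opHom g ≫ opHom f := by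
  rw [opHom_eq, opHom_eq, opHom_eq]
  exact ((dbox_comp (X := ⟨Z⟩) (Y := ⟨Y⟩) (Z := ⟨X⟩) _ _).trans
    (sound (DCsp.opHom_comp_opHom f g))).symm

/-- The isomorphism of decorated corelation categories given by an isomorphism of `C`. -/
def isoOf {X Y : C} (f : X ≅ Y) : (⟨X⟩ : DecCorel F) ≅ ⟨Y⟩ where
  hom := ofHom f.hom
  inv := ofHom f.inv
  hom_inv_id := by rw [← ofHom_comp, f.hom_inv_id, ofHom_id]
  inv_hom_id := by rw [← ofHom_comp, f.inv_hom_id, ofHom_id]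

/-- The tensor product of morphisms of decorated corelation categories. -/
def tensorHom {X Y X' Y' : DecCorel F} (f : X ⟶ Y) (g : X' ⟶ Y') :
    (⟨X.of ⨿ X'.of⟩ : DecCorel F) ⟶ ⟨Y.of ⨿ Y'.of⟩ := Hom.tensor f g

lemma dbox_tensor {X Y X' Y' : DecCorel F} (a : DCsp (mon F) X.of Y.of)
    (b : DCsp (mon F) X'.of Y'.of) :
    tensorHom (dbox a : X ⟶ Y) (dbox b : X' ⟶ Y') = dbox (a.tensor b) := Hom.ofD_box_tensor a b

lemma ofHom_tensor {X Y X' Y' : C} (f : X ⟶ Y) (g : X' ⟶ Y') :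
    tensorHom (F := F) (ofHom f) (ofHom g) = ofHom (coprod.map f g) :=
  (dbox_tensor (X := ⟨X⟩) (Y := ⟨Y⟩) (X' := ⟨X'⟩) (Y' := ⟨Y'⟩) (DCsp.ofHom f)
    (DCsp.ofHom g)).trans (congrArg (dbox (X := ⟨X ⨿ X'⟩) (Y := ⟨Y ⨿ Y'⟩))
      (DCsp.ofHom_tensor f g))

lemma opHom_tensor {X Y X' Y' : C} (f : X ⟶ Y) (g : X' ⟶ Y') :
    tensorHom (F := F) (opHom f) (opHom g) = opHom (coprod.map f g) :=
  (dbox_tensor (X := ⟨Y⟩) (Y := ⟨X⟩) (X' := ⟨Y'⟩) (Y' := ⟨X'⟩) (DCsp.opHom f)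
    (DCsp.opHom g)).trans (congrArg (dbox (X := ⟨Y ⨿ Y'⟩) (Y := ⟨X ⨿ X'⟩))
      (DCsp.opHom_tensor f g))

lemma tensorHom_braiding {X Y X' Y' : DecCorel F} (f : X ⟶ Y) (g : X' ⟶ Y') :
    tensorHom f g ≫ ofHom (coprod.braiding Y.of Y'.of).hom =
      ofHom (coprod.braiding X.of X'.of).hom ≫ tensorHom g f :=
  ind (fun a => ind (fun b => by
    rw [dbox_tensor, dbox_tensor, ofHom_eq, ofHom_eq]
    exact sound₂ (X := ⟨X.of ⨿ X'.of⟩) (Y := ⟨Y.of ⨿ Y'.of⟩) (Z := ⟨Y'.of ⨿ Y.of⟩)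
      (Y' := ⟨X'.of ⨿ X.of⟩) (DCsp.braiding_natural a b)) g) f

instance : MonoidalCategoryStruct (DecCorel F) where
  tensorObj X Y := ⟨X.of ⨿ Y.of⟩
  whiskerLeft X _ _ f := tensorHom (𝟙 X) f
  whiskerRight f Y := tensorHom f (𝟙 Y)
  tensorHom f g := tensorHom f g
  tensorUnit := ⟨⊥_ C⟩
  associator X Y Z := isoOf (coprod.associator X.of Y.of Z.of)
  leftUnitor X := isoOf (coprod.leftUnitor X.of)
  rightUnitor X := isoOf (coprod.rightUnitor X.of)

lemma tensorHom_comp {X₁ Y₁ Z₁ X₂ Y₂ Z₂ : DecCorel F} (f₁ : X₁ ⟶ Y₁) (f₂ : X₂ ⟶ Y₂)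
    (g₁ : Y₁ ⟶ Z₁) (g₂ : Y₂ ⟶ Z₂) :
    tensorHom f₁ f₂ ≫ tensorHom g₁ g₂ = tensorHom (f₁ ≫ g₁) (f₂ ≫ g₂) :=
  ind (fun a => ind (fun b => ind (fun c => ind (fun d => by
    rw [dbox_tensor, dbox_tensor, dbox_comp a c, dbox_comp b d, dbox_tensor]
    exact (dbox_comp (X := ⟨X₁.of ⨿ X₂.of⟩) (Y := ⟨Y₁.of ⨿ Y₂.of⟩) (Z := ⟨Z₁.of ⨿ Z₂.of⟩)
      _ _).trans (sound (DCsp.tensor_comp a c b d))) g₂) g₁) f₂) f₁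

lemma associator_natural {X₁ X₂ X₃ Y₁ Y₂ Y₃ : DecCorel F} (f₁ : X₁ ⟶ Y₁) (f₂ : X₂ ⟶ Y₂)
    (f₃ : X₃ ⟶ Y₃) :
    tensorHom (tensorHom f₁ f₂) f₃ ≫ ofHom (coprod.associator Y₁.of Y₂.of Y₃.of).hom =
      ofHom (coprod.associator X₁.of X₂.of X₃.of).hom ≫ tensorHom f₁ (tensorHom f₂ f₃) :=
  ind (fun a => ind (fun b => ind (fun c => by
    rw [dbox_tensor, dbox_tensor, dbox_tensor, dbox_tensor, ofHom_eq, ofHom_eq]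
    exact sound₂ (X := ⟨(X₁.of ⨿ X₂.of) ⨿ X₃.of⟩) (Y := ⟨(Y₁.of ⨿ Y₂.of) ⨿ Y₃.of⟩)
      (Z := ⟨Y₁.of ⨿ Y₂.of ⨿ Y₃.of⟩) (Y' := ⟨X₁.of ⨿ X₂.of ⨿ X₃.of⟩)
      (DCsp.assoc_natural a b c)) f₃) f₂) f₁

lemma leftUnitor_natural {X Y : DecCorel F} (f : X ⟶ Y) :
    tensorHom (𝟙 ⟨⊥_ C⟩) f ≫ ofHom (coprod.leftUnitor Y.of).hom =
      ofHom (coprod.leftUnitor X.of).hom ≫ f :=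
  ind (fun a => by
    rw [← ofHom_id, ofHom_eq, dbox_tensor, ofHom_eq, ofHom_eq]
    exact sound₂ (X := ⟨(⊥_ C) ⨿ X.of⟩) (Y := ⟨(⊥_ C) ⨿ Y.of⟩) (Z := Y) (Y' := X)
      (DCsp.leftUnitor_natural a)) f

lemma rightUnitor_natural {X Y : DecCorel F} (f : X ⟶ Y) :
    tensorHom f (𝟙 ⟨⊥_ C⟩) ≫ ofHom (coprod.rightUnitor Y.of).hom =
      ofHom (coprod.rightUnitor X.of).hom ≫ f :=
  ind (fun a => by
    rw [← ofHom_id, ofHom_eq, dbox_tensor, ofHom_eq, ofHom_eq]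
    exact sound₂ (X := ⟨X.of ⨿ (⊥_ C)⟩) (Y := ⟨Y.of ⨿ (⊥_ C)⟩) (Z := Y) (Y' := X)
      (DCsp.rightUnitor_natural a)) f

instance : MonoidalCategory (DecCorel F) := MonoidalCategory.ofTensorHom
  (id_tensorHom_id := fun X Y => by
    refine (ofHom_tensor (F := F) (𝟙 X.of) (𝟙 Y.of)).trans ?_
    rw [coprod.map_id_id]; rfl)
  (id_tensorHom := fun _ _ _ _ => rfl)
  (tensorHom_id := fun _ _ => rfl)
  (tensorHom_comp_tensorHom := tensorHom_comp)
  (associator_naturality := associator_natural)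
  (leftUnitor_naturality := leftUnitor_natural)
  (rightUnitor_naturality := rightUnitor_natural)
  (pentagon := fun W X Y Z => by
    have h := congrArg (ofHom (F := F)) (coprod.pentagon W.of X.of Y.of Z.of)
    simp only [ofHom_comp, ← ofHom_tensor] at h
    exact h)
  (triangle := fun X Y => by
    have h := congrArg (ofHom (F := F)) (coprod.triangle X.of Y.of)
    simp only [ofHom_comp, ← ofHom_tensor] at h
    exact h)

instance : SymmetricCategory (DecCorel F) where
  braiding X Y := (isoOf (coprod.braiding X.of Y.of) :
    (⟨X.of ⨿ Y.of⟩ : DecCorel F) ≅ ⟨Y.of ⨿ X.of⟩)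
  braiding_naturality_right X _ _ f := tensorHom_braiding (𝟙 X) f
  braiding_naturality_left f Z := tensorHom_braiding f (𝟙 Z)
  hexagon_forward X Y Z := by
    have h := congrArg (ofHom (F := F)) (show
      (coprod.associator X.of Y.of Z.of).hom ≫ (coprod.braiding X.of (Y.of ⨿ Z.of)).hom ≫
        (coprod.associator Y.of Z.of X.of).hom =
      coprod.map (coprod.braiding X.of Y.of).hom (𝟙 Z.of) ≫ (coprod.associator Y.of X.of Z.of).hom ≫
        coprod.map (𝟙 Y.of) (coprod.braiding X.of Z.of).hom by simp)
    simp only [ofHom_comp, ← ofHom_tensor] at h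
    exact h
  hexagon_reverse X Y Z := by
    have h := congrArg (ofHom (F := F)) (show
      (coprod.associator X.of Y.of Z.of).inv ≫ (coprod.braiding (X.of ⨿ Y.of) Z.of).hom ≫
        (coprod.associator Z.of X.of Y.of).inv =
      coprod.map (𝟙 X.of) (coprod.braiding Y.of Z.of).hom ≫ (coprod.associator X.of Z.of Y.of).inv ≫
        coprod.map (coprod.braiding X.of Z.of).hom (𝟙 Y.of) by simp)
    simp only [ofHom_comp, ← ofHom_tensor] at h
    exact h
  symmetry X Y := by
    have h := congrArg (ofHom (F := F)) (coprod.symmetry X.of Y.of)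
    simp only [ofHom_comp] at h
    exact h

end DecCorel
end DecCorelCategory

section Hypergraph

/-- A special commutative Frobenius structure on an object of a symmetric monoidal category: a
commutative monoid and a cocommutative comonoid structure satisfying the Frobenius and special
axioms. -/
structure SpecialCommFrobenius {V : Type u} [Category.{v} V] [MonoidalCategory V]
    [SymmetricCategory V] (X : V) extends MonObj X, ComonObj X where
  mul_comm : (β_ X X).hom ≫ mul = mul
  comul_comm : comul ≫ (β_ X X).hom = comul
  frobenius_left : X ◁ comul ≫ (α_ X X X).inv ≫ mul ▷ X = mul ≫ comul
  frobenius_right : comul ▷ X ≫ (α_ X X X).hom ≫ X ◁ mul = mul ≫ comul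
  special : comul ≫ mul = 𝟙 X

/-- A hypergraph category: a symmetric monoidal category in which every object is equipped with a
special commutative Frobenius structure, compatibly with the monoidal product. -/
class HypergraphCategory (V : Type u) [Category.{v} V] [MonoidalCategory V]
    [SymmetricCategory V] where
  frob : ∀ X : V, SpecialCommFrobenius X
  mul_tensor : ∀ X Y : V, (frob (X ⊗ Y)).mul = tensorμ X Y X Y ≫ ((frob X).mul ⊗ₘ (frob Y).mul)
  one_tensor : ∀ X Y : V, (frob (X ⊗ Y)).one = (λ_ (𝟙_ V)).inv ≫ ((frob X).one ⊗ₘ (frob Y).one)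
  comul_tensor : ∀ X Y : V,
    (frob (X ⊗ Y)).comul = ((frob X).comul ⊗ₘ (frob Y).comul) ≫ tensorμ X X Y Y
  counit_tensor : ∀ X Y : V,
    (frob (X ⊗ Y)).counit = ((frob X).counit ⊗ₘ (frob Y).counit) ≫ (λ_ (𝟙_ V)).hom

open Functor.LaxMonoidal Functor.OplaxMonoidal HypergraphCategory in
/-- A strong symmetric monoidal functor is a hypergraph functor if the Frobenius structure of the
image of an object is the image of its Frobenius structure. Here `δ T` and `η T` are the inverses of
the coherence maps `μ T` and `ε T`. -/
structure IsHypergraphFunctor {V : Type u} [Category.{v} V] [MonoidalCategory V]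
    [SymmetricCategory V] [HypergraphCategory V] {W : Type u'} [Category.{v'} W]
    [MonoidalCategory W] [SymmetricCategory W] [HypergraphCategory W] (T : V ⥤ W) [T.Braided] :
    Prop where
  map_mul : ∀ X : V, (frob (T.obj X)).mul = μ T X X ≫ T.map (frob X).mul
  map_one : ∀ X : V, (frob (T.obj X)).one = ε T ≫ T.map (frob X).one
  map_comul : ∀ X : V, (frob (T.obj X)).comul = T.map (frob X).comul ≫ δ T X X
  map_counit : ∀ X : V, (frob (T.obj X)).counit = T.map (frob X).counit ≫ η T

variable {C : Type u} [Category.{v} C] [HasFiniteColimits C] {S : FactorizationSystem C}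
  [S.M.IsStableUnderCobaseChange] {F : AdjoinOp S.M ⥤ Type w} [F.LaxBraided]

namespace DecCorel

open DecCsp Decoration

lemma opHom_comp_ofHom {X Y Z P : C} {f : X ⟶ Y} {g : X ⟶ Z} {j : Y ⟶ P} {k : Z ⟶ P}
    (s : IsPushout f g j k) :
    (opHom f : (⟨Y⟩ : DecCorel F) ⟶ _) ≫ ofHom g = ofHom j ≫ opHom k := by
  rw [opHom_eq, ofHom_eq, ofHom_eq, opHom_eq]
  exact sound₂ (X := ⟨Y⟩) (Y := ⟨X⟩) (Y' := ⟨P⟩) (Z := ⟨Z⟩)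
    ((DCsp.opHom_comp_ofHom s).trans (DCsp.ofHom_comp_opHom j k).symm)

lemma ofHom_iso {X Y : C} (f : X ≅ Y) :
    (ofHom f.hom : (⟨X⟩ : DecCorel F) ⟶ _) = opHom f.inv := by
  rw [ofHom_eq, opHom_eq]
  exact sound (X := ⟨X⟩) (Y := ⟨Y⟩) (DCsp.ofHom_rel_opHom f)

lemma ofHom_tensor_id {X Y : C} (f : X ⟶ Y) (Z : C) :
    (ofHom f : (⟨X⟩ : DecCorel F) ⟶ _) ▷ ⟨Z⟩ = ofHom (coprod.map f (𝟙 Z)) :=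
  ofHom_tensor f (𝟙 Z)

lemma id_tensor_ofHom {X Y : C} (f : X ⟶ Y) (Z : C) :
    (⟨Z⟩ : DecCorel F) ◁ ofHom f = ofHom (coprod.map (𝟙 Z) f) :=
  ofHom_tensor (𝟙 Z) f

lemma opHom_tensor_id {X Y : C} (f : X ⟶ Y) (Z : C) :
    (opHom f : (⟨Y⟩ : DecCorel F) ⟶ _) ▷ ⟨Z⟩ = opHom (coprod.map f (𝟙 Z)) :=
  opHom_tensor f (𝟙 Z)

lemma id_tensor_opHom {X Y : C} (f : X ⟶ Y) (Z : C) :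
    (⟨Z⟩ : DecCorel F) ◁ opHom f = opHom (coprod.map (𝟙 Z) f) :=
  opHom_tensor (𝟙 Z) f

lemma isPushout_special (X : C) :
    IsPushout (coprod.desc (𝟙 X) (𝟙 X)) (coprod.desc (𝟙 X) (𝟙 X)) (𝟙 X) (𝟙 X) := by
  refine DCsp.isPushout_of rfl (fun T p q h => ⟨p, by simp, ?_⟩) (fun T d d' h _ => by simpa using h)
  simpa using coprod.inl ≫= h

lemma isPushout_frobenius_left (X : C) :
    IsPushout (coprod.map (𝟙 X) (coprod.desc (𝟙 X) (𝟙 X)))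
      ((coprod.associator X X X).inv ≫ coprod.map (coprod.desc (𝟙 X) (𝟙 X)) (𝟙 X))
      (coprod.desc (𝟙 X) (𝟙 X)) (coprod.desc (𝟙 X) (𝟙 X)) := by
  refine DCsp.isPushout_of ?_ (fun T p q h => ⟨coprod.inl ≫ p, ?_, ?_⟩)
    (fun T d d' h _ => by simpa using coprod.inl ≫= h)
  · apply coprod.hom_ext
    · simp
    · apply coprod.hom_ext <;> simp
  all_goals
    have h1 : coprod.inl ≫ p = coprod.inl ≫ q := by simpa using coprod.inl ≫= h
    have h2 : coprod.inr ≫ p = coprod.inl ≫ q := by simpa using (coprod.inl ≫ coprod.inr) ≫= h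
    have h3 : coprod.inr ≫ p = coprod.inr ≫ q := by simpa using (coprod.inr ≫ coprod.inr) ≫= h
    apply coprod.hom_ext
  · simp
  · simp [h1, h2]
  · simp [h1]
  · simp [h1, ← h2, h3]

lemma isPushout_frobenius_right (X : C) :
    IsPushout (coprod.map (coprod.desc (𝟙 X) (𝟙 X)) (𝟙 X))
      ((coprod.associator X X X).hom ≫ coprod.map (𝟙 X) (coprod.desc (𝟙 X) (𝟙 X)))
      (coprod.desc (𝟙 X) (𝟙 X)) (coprod.desc (𝟙 X) (𝟙 X)) := by
  refine DCsp.isPushout_of ?_ (fun T p q h => ⟨coprod.inl ≫ p, ?_, ?_⟩)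
    (fun T d d' h _ => by simpa using coprod.inl ≫= h)
  · apply coprod.hom_ext
    · apply coprod.hom_ext <;> simp
    · simp
  all_goals
    have h1 : coprod.inl ≫ p = coprod.inl ≫ q := by simpa using (coprod.inl ≫ coprod.inl) ≫= h
    have h2 : coprod.inl ≫ p = coprod.inr ≫ q := by simpa using (coprod.inr ≫ coprod.inl) ≫= h
    have h3 : coprod.inr ≫ p = coprod.inr ≫ q := by simpa using coprod.inr ≫= h
    apply coprod.hom_ext
  · simp
  · simp [h2, h3]
  · simp [h1]
  · simp [h2]

/-- The Frobenius structure on an object `X` of a decorated corelation category: the cospans given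
by the codiagonal `X ⨿ X ⟶ X`, the map `⊥ ⟶ X`, and their reverses, with restricted empty
decoration. -/
def frobenius (X : C) : SpecialCommFrobenius (⟨X⟩ : DecCorel F) where
  mul := ofHom (coprod.desc (𝟙 X) (𝟙 X))
  one := ofHom (initial.to X)
  comul := opHom (coprod.desc (𝟙 X) (𝟙 X))
  counit := opHom (initial.to X)
  one_mul := by
    change _ = ofHom (coprod.leftUnitor X).hom
    rw [ofHom_tensor_id]
    refine (ofHom_comp _ _).symm.trans (congrArg _ ?_)
    apply coprod.hom_ext
    · exact Subsingleton.elim _ _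
    · simp
  mul_one := by
    change _ = ofHom (coprod.rightUnitor X).hom
    rw [id_tensor_ofHom]
    refine (ofHom_comp _ _).symm.trans (congrArg _ ?_)
    apply coprod.hom_ext
    · simp
    · exact Subsingleton.elim _ _
  mul_assoc := by
    rw [id_tensor_ofHom, ofHom_tensor_id]
    refine (ofHom_comp _ _).symm.trans (Eq.trans (congrArg ofHom ?_) ((ofHom_comp
      (coprod.associator X X X).hom _).trans (congrArg _ (ofHom_comp _ _))))
    apply coprod.hom_ext
    · apply coprod.hom_ext <;> simp
    · simp
  mul_comm := by
    refine (ofHom_comp (coprod.braiding X X).hom _).symm.trans (congrArg _ ?_)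
    simp
  counit_comul := by
    change _ = ofHom (coprod.leftUnitor X).symm.hom
    rw [ofHom_iso, opHom_tensor_id]
    refine (opHom_comp _ _).symm.trans (congrArg _ ?_)
    apply coprod.hom_ext
    · exact Subsingleton.elim _ _
    · simp
  comul_counit := by
    change _ = ofHom (coprod.rightUnitor X).symm.hom
    rw [ofHom_iso, id_tensor_opHom]
    refine (opHom_comp _ _).symm.trans (congrArg _ ?_)
    apply coprod.hom_ext
    · simp
    · exact Subsingleton.elim _ _
  comul_assoc := by
    have h : (α_ (⟨X⟩ : DecCorel F) ⟨X⟩ ⟨X⟩).hom = opHom (coprod.associator X X X).inv :=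
      ofHom_iso (coprod.associator X X X)
    rw [id_tensor_opHom, opHom_tensor_id, h]
    refine (opHom_comp _ _).symm.trans (Eq.trans (congrArg opHom ?_) ((opHom_comp
      ((coprod.associator X X X).inv ≫ _) _).trans (congrArg _ (opHom_comp _ _))))
    apply coprod.hom_ext
    · simp
    · apply coprod.hom_ext <;> simp
  comul_comm := by
    have h : (β_ (⟨X⟩ : DecCorel F) ⟨X⟩).hom = opHom (coprod.braiding X X).inv :=
      ofHom_iso (coprod.braiding X X)
    rw [h]
    refine (opHom_comp (coprod.braiding X X).inv _).symm.trans (congrArg _ ?_)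
    simp
  frobenius_left := by
    rw [id_tensor_opHom, ofHom_tensor_id]
    refine (congrArg _ (ofHom_comp (coprod.associator X X X).inv _).symm).trans ?_
    exact opHom_comp_ofHom (isPushout_frobenius_left X)
  frobenius_right := by
    rw [opHom_tensor_id, id_tensor_ofHom]
    refine (congrArg _ (ofHom_comp (coprod.associator X X X).hom _).symm).trans ?_
    exact opHom_comp_ofHom (isPushout_frobenius_right X)
  special := by
    rw [opHom_comp_ofHom (isPushout_special X), ofHom_id]
    exact Category.id_comp _

/-- The isomorphism `(X ⨿ Y) ⨿ (X' ⨿ Y') ≅ (X ⨿ X') ⨿ (Y ⨿ Y')`. -/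
def interchange (X Y X' Y' : C) : (X ⨿ Y) ⨿ (X' ⨿ Y') ≅ (X ⨿ X') ⨿ (Y ⨿ Y') where
  hom := coprod.desc (coprod.map coprod.inl coprod.inl) (coprod.map coprod.inr coprod.inr)
  inv := coprod.desc (coprod.map coprod.inl coprod.inl) (coprod.map coprod.inr coprod.inr)
  hom_inv_id := by apply coprod.hom_ext <;> apply coprod.hom_ext <;> simp
  inv_hom_id := by apply coprod.hom_ext <;> apply coprod.hom_ext <;> simp

lemma codiag_eq (X Y : C) : coprod.desc (𝟙 (X ⨿ Y)) (𝟙 (X ⨿ Y)) = (interchange X Y X Y).hom ≫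
    coprod.map (coprod.desc (𝟙 X) (𝟙 X)) (coprod.desc (𝟙 Y) (𝟙 Y)) := by
  apply coprod.hom_ext <;> apply coprod.hom_ext <;> simp [interchange]

lemma tensorμ_eq (X Y X' Y' : C) :
    tensorμ (⟨X⟩ : DecCorel F) ⟨Y⟩ ⟨X'⟩ ⟨Y'⟩ = ofHom (interchange X Y X' Y').hom := by
  have h := congrArg (ofHom (F := F)) (show (interchange X Y X' Y').hom =
    (coprod.associator X Y (X' ⨿ Y')).hom ≫
      coprod.map (𝟙 X) (coprod.associator Y X' Y').inv ≫
        coprod.map (𝟙 X) (coprod.map (coprod.braiding Y X').hom (𝟙 Y')) ≫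
          coprod.map (𝟙 X) (coprod.associator X' Y Y').hom ≫
            (coprod.associator X X' (Y ⨿ Y')).inv by
    apply coprod.hom_ext <;> apply coprod.hom_ext <;> simp [interchange])
  simp only [ofHom_comp, ← ofHom_tensor] at h
  exact h.symm

instance : HypergraphCategory (DecCorel F) where
  frob X := frobenius X.of
  mul_tensor := by
    rintro ⟨X⟩ ⟨Y⟩
    rw [tensorμ_eq]
    refine Eq.trans (congrArg ofHom ?_) ((ofHom_comp _ _).trans
      (congrArg _ (ofHom_tensor _ _).symm))
    exact codiag_eq X Y
  one_tensor := by
    rintro ⟨X⟩ ⟨Y⟩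
    refine Eq.trans (congrArg ofHom ?_) ((ofHom_comp (coprod.leftUnitor (⊥_ C)).inv _).trans
      (congrArg _ (ofHom_tensor _ _).symm))
    exact Subsingleton.elim _ _
  comul_tensor := by
    rintro ⟨X⟩ ⟨Y⟩
    rw [tensorμ_eq, ofHom_iso]
    refine Eq.trans (congrArg opHom ?_) ((opHom_comp _ _).trans
      (congrArg (· ≫ opHom _) (opHom_tensor _ _).symm))
    exact codiag_eq X Y
  counit_tensor := by
    rintro ⟨X⟩ ⟨Y⟩
    have h : (λ_ (𝟙_ (DecCorel F))).hom = opHom (coprod.leftUnitor (⊥_ C)).inv :=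
      ofHom_iso (coprod.leftUnitor (⊥_ C))
    rw [h]
    refine Eq.trans (congrArg opHom ?_) ((opHom_comp (coprod.leftUnitor (⊥_ C)).inv _).trans
      (congrArg (· ≫ opHom _) (opHom_tensor _ _).symm))
    exact Subsingleton.elim _ _

end DecCorel
end Hypergraph

section MapDecCorel

variable {C : Type u} [Category.{v} C] [HasFiniteColimits C] {S : FactorizationSystem C}
  [S.M.IsStableUnderCobaseChange] {C' : Type u'} [Category.{v'} C'] [HasFiniteColimits C']
  {S' : FactorizationSystem C'} [S'.M.IsStableUnderCobaseChange]
  {F : AdjoinOp S.M ⥤ Type w} {G : AdjoinOp S'.M ⥤ Type w}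
  (A : C ⥤ C') [PreservesFiniteColimits A] (hA : S.M ≤ S'.M.inverseImage A)
  (θ : F ⟶ AdjoinOp.extend A hA ⋙ G)

/-- The image of a decorated cospan: apply `A` to the cospan and `θ` to the decoration. -/
def DecCsp.map {X Y : C} (a : DecCsp F X Y) : DecCsp G (A.obj X) (A.obj Y) where
  toCsp := a.toCsp.map A
  dec := θ.app ⟨a.apex⟩ a.dec

lemma DecCsp.Rel.map {X Y : C} {a b : DecCsp F X Y} :
    DecCsp.Rel a b → DecCsp.Rel (a.map A hA θ) (b.map A hA θ) := by
  rintro ⟨n, h1, h2, h3⟩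
  refine ⟨A.mapIso n, ?_, ?_, ?_⟩
  · change A.map a.i ≫ A.map n.hom = A.map b.i
    rw [← A.map_comp, h1]
  · change A.map a.o ≫ A.map n.hom = A.map b.o
    rw [← A.map_comp, h2]
  · have h := Decoration.congr_type (θ.naturality (AdjoinOp.ofHom n.hom)) a.dec
    change G.map (AdjoinOp.ofHom (A.map n.hom)) (θ.app ⟨a.apex⟩ a.dec) = θ.app ⟨b.apex⟩ b.dec
    rw [← h3, ← AdjoinOp.extend_ofHom A hA]
    exact h.symm

variable [F.LaxBraided] [G.LaxBraided]

/-- The map sending the class of a decorated corelation to the class of the `E'`-part, with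
restricted decoration, of its image under `A` and `θ`. -/
def DecCorel.mapHom {X Y : DecCorel F} (f : X ⟶ Y) :
    (⟨A.obj X.of⟩ : DecCorel G) ⟶ ⟨A.obj Y.of⟩ :=
  Quotient.map (sa := homSetoid F X.of Y.of) (sb := homSetoid G (A.obj X.of) (A.obj Y.of))
    (fun a => ⟨(a.1.map A hA θ).ePart, DecCsp.jointlyE_ePart _⟩)
    (fun _ _ h => Quotient.exact (s := homSetoid G (A.obj X.of) (A.obj Y.of))
      (Hom.sound (X := ⟨A.obj X.of⟩) (Y := ⟨A.obj Y.of⟩) (DecCsp.Rel.map A hA θ h))) f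

end MapDecCorel

end

end DecoratedCorelations

open DecoratedCorelations

namespace DecoratedCorelations

noncomputable section

attribute [local simp] coprod.inl_desc coprod.inr_desc inl_kappa inr_kappa inl_kappa_assoc
  inr_kappa_assoc

variable {C : Type u} [Category.{v} C] [HasFiniteColimits C] {S : FactorizationSystem C}
  [S.M.IsStableUnderCobaseChange] {C' : Type u'} [Category.{v'} C'] [HasFiniteColimits C']
  {S' : FactorizationSystem C'} [S'.M.IsStableUnderCobaseChange]
  {F : AdjoinOp S.M ⥤ Type w} {G : AdjoinOp S'.M ⥤ Type w}
  (A : C ⥤ C') [PreservesFiniteColimits A] (hA : S.M ≤ S'.M.inverseImage A)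

/-! The difficulty is that a composite of decorated corelations is formed in two stages, a pushout
followed by passage to the `E`-part, while `A` is not asked to respect `E`. A corelation may
therefore be sent to a cospan that is no longer jointly `E'`-like, and a factorisation has to be
taken again on the other side. The proof shows that all these factorisations can be postponed to the
end.

The tool is the relation `Res`: one decorated cospan is the restriction of another along a map of
`M` between the apices. By essential uniqueness of factorisations, a decorated cospan has, up to
isomorphism, only one jointly `E`-like restriction, its `E`-part. Hence `box`, the class of the
`E`-part, takes the same value on both sides of a restriction. Since `A` carries `M` into `M'` and
`θ` is natural with respect to reversed maps of `M`, the image of a restriction is again a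
restriction (`Res.map`). Consequently `mapHom` can be evaluated on an arbitrary decorated cospan
representing a morphism, without taking its `E`-part beforehand (`mapHom_box`).

Together with `box_comp` and `box_tensor`, this moves every equation to the level of decorated
cospans. Composites are preserved because `A` preserves pushouts and `θ` is compatible with the
laxators (`map_comp_rel`). Identities, and more generally all cospans with empty decoration, are
preserved because `θ` is compatible with the units (`map_emptyDec`). Products are preserved up to
the comparison of coproducts at the apices (`map_tensor_rel`).

The remaining coherence is inherited from the base category. The structural maps and the Frobenius
maps come from `ofHom` and `opHom`, which are functorial (the second contravariantly) and compatible
with coproducts, and `mapHom` acts on them by applying `A`. So each axiom for the coherence maps or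
the Frobenius structure reduces to an identity about `kappa` and `kappaUnit` in `C'`, checked on
coproduct injections or by initiality. -/

lemma AdjoinOp.extend_opHom {X Y : C} (m : X ⟶ Y) (hm : S.M m) :
    (AdjoinOp.extend A hA).map (opHom m hm) = opHom (A.map m) (hA m hm) :=
  sound (X := ⟨A.obj Y⟩) (Y := ⟨A.obj X⟩) (a := (Csp.opHom m).map A) (b := Csp.opHom (A.map m))
    (DCsp.mkRel (Iso.refl _) (by simp [Csp.opHom]) (by simp [Csp.opHom]) rfl)

variable (θ : F ⟶ AdjoinOp.extend A hA ⋙ G)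

/-! ### Transport of decorations along `θ` -/

namespace Decoration

/-- The component of `θ` at `N`, as a map of decorations. -/
def mapDec {N : C} (s : F.obj ⟨N⟩) : G.obj ⟨A.obj N⟩ := θ.app ⟨N⟩ s

lemma mapDec_push {X Y : C} (f : X ⟶ Y) (s : F.obj ⟨X⟩) :
    mapDec A hA θ (push F f s) = push G (A.map f) (mapDec A hA θ s) := by
  have h := congr_type (θ.naturality (AdjoinOp.ofHom f)) s
  rw [Functor.comp_map, AdjoinOp.extend_ofHom A hA] at h
  exact h

/-- This is naturality of `θ` at reversed maps of `M`, which is what makes images of restrictions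
into restrictions. -/
lemma mapDec_pull {X Y : C} (m : X ⟶ Y) (hm : S.M m) (s : F.obj ⟨Y⟩) :
    mapDec A hA θ (pull F m hm s) = pull G (A.map m) (hA m hm) (mapDec A hA θ s) := by
  have h := congr_type (θ.naturality (AdjoinOp.opHom m hm)) s
  rw [Functor.comp_map, AdjoinOp.extend_opHom A hA] at h
  exact h

variable [F.LaxBraided] [G.LaxBraided] [NatTrans.IsMonoidal θ]

/-- The laxator of the composite of `G` with the extension of `A` is the laxator of `G` followed by
`G` applied to the coherence map of the extension. That coherence map is `kappa`, which explains the
extra `push`. -/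
lemma mapDec_pair {X Y : C} (s : F.obj ⟨X⟩) (t : F.obj ⟨Y⟩) :
    mapDec A hA θ (pair F s t) =
      push G (kappa A X Y).hom (pair G (mapDec A hA θ s) (mapDec A hA θ t)) :=
  congr_type (NatTrans.IsMonoidal.tensor (τ := θ) ⟨X⟩ ⟨Y⟩) ((s, t) : _ × _)

/-- This is the shape of the decoration on a composite cospan. The comparison `kappa` disappears
because precomposing the image of a copairing with it gives the copairing of the images. -/
lemma mapDec_push_desc_pair {X Y Z : C} (f : X ⟶ Z) (g : Y ⟶ Z) (s : F.obj ⟨X⟩) (t : F.obj ⟨Y⟩) :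
    mapDec A hA θ (push F (coprod.desc f g) (pair F s t)) =
      push G (coprod.desc (A.map f) (A.map g)) (pair G (mapDec A hA θ s) (mapDec A hA θ t)) := by
  rw [mapDec_push, mapDec_pair, push_push]
  congr 1
  apply coprod.hom_ext <;> simp [← Functor.map_comp]

lemma mapDec_empty (N : C) : mapDec A hA θ (empty F N) = empty G (A.obj N) := by
  have h : mapDec A hA θ (Functor.LaxMonoidal.ε F PUnit.unit) =
      push G (kappaUnit A).hom (Functor.LaxMonoidal.ε G PUnit.unit) :=
    congr_type (NatTrans.IsMonoidal.unit (τ := θ)) PUnit.unit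
  rw [empty, mapDec_push, h, push_push]
  congr 1
  -- Both sides are now maps out of the initial object of `C'`.
  exact Subsingleton.elim _ _

end Decoration

/-! ### Images of decorated cospans -/

namespace DecCsp

open Decoration

/-- The image under `A` of the restricting map lies in `M'`, so it exhibits the restriction on the
other side. This is where preservation of `M` makes up for the lack of any condition on `E`. -/
lemma Res.map {X Y : C} {a b : DecCsp F X Y} :
    Res a b → Res (a.map A hA θ) (b.map A hA θ) := by
  rintro ⟨m, hm, h1, h2, h3⟩
  refine ⟨A.map m, hA m hm, ?_, ?_, ?_⟩
  · change A.map b.i ≫ A.map m = A.map a.i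
    rw [← A.map_comp, h1]
  · change A.map b.o ≫ A.map m = A.map a.o
    rw [← A.map_comp, h2]
  · exact (mapDec_pull A hA θ m hm a.dec).symm.trans (congrArg (mapDec A hA θ) h3)

variable [F.LaxBraided] [G.LaxBraided] [NatTrans.IsMonoidal θ]

lemma map_emptyDec {X Y : C} (a : Csp X Y) :
    (emptyDec a : DecCsp F X Y).map A hA θ = emptyDec (a.map A) :=
  congrArg (DecCsp.mk (a.map A)) (mapDec_empty A hA θ a.apex)

/-- Only an isomorphism can be expected, since the image of the chosen pushout in `C` need not be
the chosen pushout in `C'`. `IsComp` accepts any pushout square, so it suffices that `A` preserves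
the square. -/
lemma map_comp_rel {X Y Z : C} (a : DecCsp F X Y) (b : DecCsp F Y Z) :
    Rel ((a.map A hA θ).comp (b.map A hA θ)) ((a.comp b).map A hA θ) := by
  rw [← ofD_comp]
  refine DCsp.IsComp.comp_rel (a := (a.map A hA θ).toD) (b := (b.map A hA θ).toD)
    (c := ((a.comp b).map A hA θ).toD)
    (DCsp.mkComp (A.map (pushout.inl a.o b.i)) (A.map (pushout.inr a.o b.i))
      ((IsPushout.of_hasPushout a.o b.i).map A)
      (A.map_comp _ _).symm (A.map_comp _ _).symm ?_)
  -- The auxiliary calculus multiplies the two pushed decorations on the common apex; this product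
  -- is the pair of decorations pushed along the copairing.
  exact (push_mul_push G _ _ _ _).trans (mapDec_push_desc_pair A hA θ _ _ _ _).symm

/-- This is naturality of the monoidal comparison before `E`-parts are taken. The isomorphism of
apices is induced by `kappa` at the two apices, and monoidality of `θ` says that it matches the
decorations. -/
lemma map_tensor_rel {X Y X' Y' : C} (a : DecCsp F X Y) (b : DecCsp F X' Y') :
    DCsp.Rel
      (((a.map A hA θ).tensor (b.map A hA θ)).toD.comp (DCsp.ofHom (kappa A Y Y').hom))
      ((DCsp.ofHom (kappa A X X').hom).comp ((a.tensor b).map A hA θ).toD) :=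
  DCsp.natural _ _ (kappa A a.apex b.apex) (map_kappa A _ _) (map_kappa A _ _)
    (mapDec_pair A hA θ _ _).symm

end DecCsp

/-! ### The induced map on decorated corelations -/

namespace DecCorel

open DecCsp Decoration

variable [F.LaxBraided] [G.LaxBraided]

lemma mapHom_homMk {X Y : DecCorel F} (a : DecCsp F X.of Y.of) (ha : a.JointlyE) :
    mapHom A hA θ (homMk a ha : X ⟶ Y) = box (a.map A hA θ) := rfl

/-- By definition the left side is computed from the image of the `E`-part. That image is a
restriction of the image of the whole cospan, and `box` does not distinguish the two. -/
lemma mapHom_box {X Y : DecCorel F} (a : DecCsp F X.of Y.of) :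
    mapHom A hA θ (box a : X ⟶ Y) = box (a.map A hA θ) :=
  (Hom.box_eq_of_res (X := ⟨A.obj X.of⟩) (Y := ⟨A.obj Y.of⟩)
    (Res.map A hA θ a.res_ePart)).symm

lemma box_ind {X Y : DecCorel F} {p : (X ⟶ Y) → Prop}
    (h : ∀ a : DecCsp F X.of Y.of, p (box a)) (f : X ⟶ Y) : p f := Hom.ind h f

lemma box_comp {X Y Z : DecCorel F} (a : DecCsp F X.of Y.of) (b : DecCsp F Y.of Z.of) :
    (box a : X ⟶ Y) ≫ (box b : Y ⟶ Z) = box (a.comp b) := Hom.box_comp a b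

lemma box_tensor {X Y X' Y' : DecCorel F} (a : DecCsp F X.of Y.of) (b : DecCsp F X'.of Y'.of) :
    tensorHom (box a : X ⟶ Y) (box b : X' ⟶ Y') = box (a.tensor b) := Hom.box_tensor a b

variable [NatTrans.IsMonoidal θ]

lemma mapHom_ofHom {X Y : C} (f : X ⟶ Y) :
    mapHom A hA θ (ofHom f : (⟨X⟩ : DecCorel F) ⟶ ⟨Y⟩) = ofHom (A.map f) := by
  rw [ofHom, mapHom_box, map_emptyDec]
  congr 2
  -- The cospans differ only in the identity leg, which `A` preserves.
  simp [Csp.map]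

lemma mapHom_opHom {X Y : C} (f : X ⟶ Y) :
    mapHom A hA θ (opHom f : (⟨Y⟩ : DecCorel F) ⟶ ⟨X⟩) = opHom (A.map f) := by
  rw [opHom, mapHom_box, map_emptyDec]
  congr 2
  simp [Csp.map]

lemma mapHom_id (X : DecCorel F) :
    mapHom A hA θ (𝟙 X) = 𝟙 (⟨A.obj X.of⟩ : DecCorel G) := by
  have h := mapHom_ofHom A hA θ (𝟙 X.of)
  rw [A.map_id] at h
  exact h

lemma mapHom_comp {X Y Z : DecCorel F} (f : X ⟶ Y) (g : Y ⟶ Z) :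
    mapHom A hA θ (f ≫ g) = mapHom A hA θ f ≫ mapHom A hA θ g := by
  induction f using box_ind with | h a
  induction g using box_ind with | h b
  rw [box_comp, mapHom_box, mapHom_box, mapHom_box, box_comp]
  -- Each side is now the `box` of a single decorated cospan, so an isomorphism of cospans is
  -- enough.
  exact (Hom.sound (X := ⟨A.obj X.of⟩) (Y := ⟨A.obj Z.of⟩) (map_comp_rel A hA θ a b)).symm

lemma mapHom_tensor {X Y X' Y' : DecCorel F} (f : X ⟶ Y) (g : X' ⟶ Y') :
    tensorHom (mapHom A hA θ f) (mapHom A hA θ g) ≫ ofHom (kappa A Y.of Y'.of).hom =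
      ofHom (kappa A X.of X'.of).hom ≫ mapHom A hA θ (tensorHom f g) := by
  induction f using box_ind with | h a
  induction g using box_ind with | h b
  rw [box_tensor, mapHom_box A hA θ a, mapHom_box A hA θ b,
    mapHom_box (X := ⟨X.of ⨿ X'.of⟩) (Y := ⟨Y.of ⨿ Y'.of⟩) A hA θ (a.tensor b),
    box_tensor (X := ⟨A.obj X.of⟩) (Y := ⟨A.obj Y.of⟩) (X' := ⟨A.obj X'.of⟩)
      (Y' := ⟨A.obj Y'.of⟩) (a.map A hA θ) (b.map A hA θ)]
  have h := sound₂ (X := ⟨A.obj X.of ⨿ A.obj X'.of⟩) (Y := ⟨A.obj Y.of ⨿ A.obj Y'.of⟩)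
    (Y' := ⟨A.obj (X.of ⨿ X'.of)⟩) (Z := ⟨A.obj (Y.of ⨿ Y'.of)⟩)
    (a := ((a.map A hA θ).tensor (b.map A hA θ)).toD)
    (b := DCsp.ofHom (kappa A Y.of Y'.of).hom)
    (a' := DCsp.ofHom (kappa A X.of X'.of).hom)
    (b' := ((a.tensor b).map A hA θ).toD) (map_tensor_rel A hA θ a b)
  exact h

/-! ### The symmetric monoidal functor -/

/-- The functor between decorated corelation categories induced by `A` and `θ`. -/
def mapFunctor : DecCorel F ⥤ DecCorel G where
  obj X := ⟨A.obj X.of⟩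
  map f := mapHom A hA θ f
  map_id := mapHom_id A hA θ
  map_comp := mapHom_comp A hA θ

lemma mapFunctor_map_ofHom {X Y : C} (f : X ⟶ Y) :
    (mapFunctor A hA θ).map (ofHom f : (⟨X⟩ : DecCorel F) ⟶ ⟨Y⟩) = ofHom (A.map f) :=
  mapHom_ofHom A hA θ f

lemma mapFunctor_map_opHom {X Y : C} (f : X ⟶ Y) :
    (mapFunctor A hA θ).map (opHom f : (⟨Y⟩ : DecCorel F) ⟶ ⟨X⟩) = opHom (A.map f) :=
  mapHom_opHom A hA θ f

/-- The structure maps making `mapFunctor A hA θ` a strong monoidal functor: the comparison maps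
`A X ⨿ A Y ≅ A (X ⨿ Y)` and `⊥ ≅ A ⊥`, as cospans with restricted empty decoration. -/
def mapFunctorCore : (mapFunctor A hA θ).CoreMonoidal where
  εIso := isoOf (kappaUnit A)
  μIso X Y := isoOf (kappa A X.of Y.of)
  μIso_hom_natural_left {X Y} f X' := by
    have h := mapHom_tensor A hA θ f (𝟙 X')
    -- Whiskering is the product with an identity, so the image of that identity must be recognised
    -- as an identity.
    rw [mapHom_id] at h
    exact h
  μIso_hom_natural_right {X Y} X' f := by
    have h := mapHom_tensor A hA θ (𝟙 X') f
    rw [mapHom_id] at h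
    exact h
  associativity X Y Z := by
    have h := congrArg (ofHom (F := G)) (kappa_assoc A X.of Y.of Z.of)
    -- The identity in `C'` is distributed over composites and coproducts, and each `ofHom` of an
    -- image under `A` is read as a value of the functor.
    simp only [ofHom_comp, ← ofHom_tensor, ← mapFunctor_map_ofHom A hA θ] at h
    exact h
  left_unitality X := by
    have h := congrArg (ofHom (F := G)) (kappa_left A X.of)
    simp only [ofHom_comp, ← ofHom_tensor, ← mapFunctor_map_ofHom A hA θ] at h
    exact h
  right_unitality X := by
    have h := congrArg (ofHom (F := G)) (kappa_right A X.of)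
    simp only [ofHom_comp, ← ofHom_tensor, ← mapFunctor_map_ofHom A hA θ] at h
    exact h

instance mapFunctorBraided : (mapFunctor A hA θ).Braided where
  __ := (mapFunctorCore A hA θ).toMonoidal
  braided X Y := by
    have h := congrArg (ofHom (F := G)) (kappa_braiding A X.of Y.of)
    simp only [ofHom_comp, ← mapFunctor_map_ofHom A hA θ] at h
    exact h

/-! ### Preservation of the Frobenius structures -/

lemma kappa_codiag (X : C) :
    (kappa A X X).hom ≫ A.map (coprod.desc (𝟙 X) (𝟙 X)) =
      coprod.desc (𝟙 (A.obj X)) (𝟙 (A.obj X)) := by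
  apply coprod.hom_ext <;> simp [← Functor.map_comp]

lemma kappaUnit_initial_to (X : C) :
    (kappaUnit A).hom ≫ A.map (initial.to X) = initial.to (A.obj X) :=
  Subsingleton.elim _ _

/-- The comultiplication and counit axioms involve inverse coherence maps, which are `ofHom` of
inverses, whereas reversing an identity in `C'` produces `opHom`. This equality reconciles the two.
-/
lemma ofHom_iso_inv {X Y : C} (f : X ≅ Y) :
    (ofHom f.inv : (⟨Y⟩ : DecCorel F) ⟶ _) = opHom f.hom := ofHom_iso f.symm

lemma isHypergraphFunctor_mapFunctor : IsHypergraphFunctor (mapFunctor A hA θ) where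
  map_mul X := by
    refine (congrArg ofHom (kappa_codiag A X.of)).symm.trans ((ofHom_comp _ _).trans ?_)
    rw [← mapFunctor_map_ofHom A hA θ]
    rfl
  map_one X := by
    refine (congrArg ofHom (kappaUnit_initial_to A X.of)).symm.trans ((ofHom_comp _ _).trans ?_)
    rw [← mapFunctor_map_ofHom A hA θ]
    rfl
  map_comul X := by
    refine (congrArg opHom (kappa_codiag A X.of)).symm.trans ((opHom_comp _ _).trans ?_)
    -- Reversing the codiagonal identity turns the factor `kappa` into its reverse, which is the
    -- inverse coherence map required here.
    rw [← mapFunctor_map_opHom A hA θ, ← ofHom_iso_inv]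
    rfl
  map_counit X := by
    refine (congrArg opHom (kappaUnit_initial_to A X.of)).symm.trans ((opHom_comp _ _).trans ?_)
    rw [← mapFunctor_map_opHom A hA θ, ← ofHom_iso_inv]
    rfl

end DecCorel

end

end DecoratedCorelations

theorem mainTheorem4
    {C : Type u} [Category.{v} C] [HasFiniteColimits C]
    {C' : Type u'} [Category.{v'} C'] [HasFiniteColimits C']
    (S : FactorizationSystem C) [S.M.IsStableUnderCobaseChange]
    (S' : FactorizationSystem C') [S'.M.IsStableUnderCobaseChange]
    (F : AdjoinOp S.M ⥤ Type w) [F.LaxBraided]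
    (G : AdjoinOp S'.M ⥤ Type w) [G.LaxBraided]
    (A : C ⥤ C') [PreservesFiniteColimits A] (hA : S.M ≤ S'.M.inverseImage A)
    (θ : F ⟶ AdjoinOp.extend A hA ⋙ G) [NatTrans.IsMonoidal θ] :
    ∃ (map_id : ∀ X : DecCorel F,
        DecCorel.mapHom A hA θ (𝟙 X) = 𝟙 (⟨A.obj X.of⟩ : DecCorel G))
      (map_comp : ∀ (X Y Z : DecCorel F) (f : X ⟶ Y) (g : Y ⟶ Z),
        DecCorel.mapHom A hA θ (f ≫ g) = DecCorel.mapHom A hA θ f ≫ DecCorel.mapHom A hA θ g),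
      let T : DecCorel F ⥤ DecCorel G :=
        { obj := fun X => ⟨A.obj X.of⟩
          map := fun f => DecCorel.mapHom A hA θ f
          map_id := map_id
          map_comp := fun f g => map_comp _ _ _ f g }
      (∀ (X Y : DecCorel F) (a : DecCsp F X.of Y.of) (ha : a.JointlyE),
        T.map (DecCorel.homMk a ha : X ⟶ Y) = DecCorel.box (a.map A hA θ)) ∧
      ∃ _ : T.Braided, IsHypergraphFunctor T ∧
        (∀ X Y : DecCorel F,
          Functor.LaxMonoidal.μ T X Y = DecCorel.ofHom (kappa A X.of Y.of).hom) ∧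
        Functor.LaxMonoidal.ε T = DecCorel.ofHom (kappaUnit A).hom :=
  -- With these two proofs inserted, the functor `T` of the statement unfolds to `mapFunctor`, so
  -- its braided structure applies to `T` and the formulas for the coherence maps hold by
  -- definition.
  ⟨DecCorel.mapHom_id A hA θ, fun _ _ _ => DecCorel.mapHom_comp A hA θ,
    fun _ _ => DecCorel.mapHom_homMk A hA θ,
    DecCorel.mapFunctorBraided A hA θ,
    DecCorel.isHypergraphFunctor_mapFunctor A hA θ, fun _ _ => rfl, rfl⟩
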